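/- Let $\ell:\mathbb{R}^{d_\theta}\times\mathbb{R}^{d_x}\to\mathbb{R}$ be differentiable with a Lipschitz gradient: there is $K>0$ such that $\|\nabla_{(\theta,x)}\ell(\theta,x)-\nabla_{(\theta,x)}\ell(\theta',x')\|\le K\|(\theta,x)-(\theta',x')\|$ for all $(\theta,x),(\theta',x')$. Let $\eta_\theta,\gamma_\theta,\eta_x,\gamma_x>0$, let $\theta_0,m_0\in\mathbb{R}^{d_\theta}$, and let $q_0$ be a probability measure on $\mathbb{R}^{d_x}\times\mathbb{R}^{d_x}$ with finite second moment. Let $(\theta_t,m_t,X_t,U_t)_{t\ge 0}$ (with $(\theta_t,m_t)$ deterministic) solve the mean-field flow $$\mathrm{d}\theta_t=\eta_\theta m_t\,\mathrm{d}t,\qquad \mathrm{d}m_t=\Big[\int\nabla_\theta\ell(\theta_t,x)\,q_{t,X}(\mathrm{d}x)-\gamma_\theta\eta_\theta m_t\Big]\mathrm{d}t,$$ $$\mathrm{d}X_t=\eta_xU_t\,\mathrm{d}t,\qquad \mathrm{d}U_t=[\nabla_x\ell(\theta_t,X_t)-\gamma_x\eta_xU_t]\,\mathrm{d}t+\sqrt{2\gamma_x}\,\mathrm{d}W_t,$$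 where $q_{t,X}=\mathrm{Law}(X_t)$, $W$ is a standard Wiener process in $\mathbb{R}^{d_x}$, the initial value of $(\theta,m)$ is $(\theta_0,m_0)$, and $(X_0,U_0)\sim q_0$ is independent of $W$. Put $q_t=\mathrm{Law}(X_t,U_t)$. For every $M\ge 1$ let $(\theta^M_t,m^M_t,(X^{i,M}_t,U^{i,M}_t)_{i=1}^M)_{t\ge 0}$ solve the $M$-particle system $$\mathrm{d}\theta^M_t=\eta_\theta m^M_t\,\mathrm{d}t,\qquad \mathrm{d}m^M_t=\Big[\frac1M\sum_{i=1}^M\nabla_\theta\ell(\theta^M_t,X^{i,M}_t)-\gamma_\theta\eta_\theta m^M_t\Big]\mathrm{d}t,$$ $$\mathrm{d}X^{i,M}_t=\eta_xU^{i,M}_t\,\mathrm{d}t,\qquad \mathrm{d}U^{i,M}_t=[\nabla_x\ell(\theta^M_t,X^{i,M}_t)-\gamma_x\eta_xU^{i,M}_t]\,\mathrm{d}t+\sqrt{2\gamma_x}\,\mathrm{d}W^i_t,$$ with $(\theta^M_0,m^M_0)=(\theta_0,m_0)$ and with $((X^{i,M}_0,U^{i,M}_0),W^i)$, $1\le i\le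 M$, independent copies of $((X_0,U_0),W)$. Put $q^M_t=\mathrm{Law}\big((X^{i,M}_t,U^{i,M}_t)_{i=1}^M\big)$. Then for every $T\ge 0$ $$\lim_{M\to\infty}\mathbb{E}\sup_{t\in[0,T]}\Big\{\|(\theta_t,m_t)-(\theta^M_t,m^M_t)\|^2+\mathsf{W}_2^2\big(q_t^{\otimes M},q^M_t\big)\Big\}=0,$$ where $\mathsf{W}_2$ is the Wasserstein-2 distance for the normalized Euclidean metric on the configuration space $(\mathbb{R}^{d_x}\times\mathbb{R}^{d_x})^M$, that is, $$\mathsf{W}_2^2(\mu,\nu)=\inf_{\pi}\int\frac1M\sum_{i=1}^M\|z_i-z_i'\|^2\,\pi(\mathrm{d}z,\mathrm{d}z'),$$ the infimum being over all couplings $\pi$ of $\mu$ and $\nu$. -/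

import Mathlib

open MeasureTheory ProbabilityTheory Filter Topology
open scoped NNReal ENNReal

noncomputable section

/-- `ℝⁿ` with its Euclidean norm. -/
abbrev EVec (n : ℕ) : Type := EuclideanSpace ℝ (Fin n)

/-- `ℝᵐ × ℝⁿ` with its Euclidean norm, `‖(a, b)‖² = ‖a‖² + ‖b‖²`. -/
abbrev EPair (m n : ℕ) : Type := WithLp 2 (EVec m × EVec n)

/-- The point `(a, b)` of `ℝᵐ × ℝⁿ`. -/
abbrev epair {m n : ℕ} (a : EVec m) (b : EVec n) : EPair m n := WithLp.toLp 2 (a, b)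

/-- The potential `ℓ : ℝ^{dθ} × ℝ^{dx} → ℝ` is differentiable and its full gradient
`∇_{(θ,x)} ℓ` is `K`-Lipschitz for some `K > 0`. -/
def HasLipschitzGradient {dθ dx : ℕ} (ell : EPair dθ dx → ℝ) : Prop :=
  Differentiable ℝ ell ∧
    ∃ K : ℝ, 0 < K ∧ ∀ z z' : EPair dθ dx, ‖gradient ell z - gradient ell z'‖ ≤ K * ‖z - z'‖

/-- The partial gradient `∇_θ ℓ(θ, x)`. -/
def gradTheta {dθ dx : ℕ} (ell : EPair dθ dx → ℝ) (θ : EVec dθ) (x : EVec dx) : EVec dθ :=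
  gradient (fun θ' : EVec dθ => ell (epair θ' x)) θ

/-- The partial gradient `∇_x ℓ(θ, x)`. -/
def gradX {dθ dx : ℕ} (ell : EPair dθ dx → ℝ) (θ : EVec dθ) (x : EVec dx) : EVec dx :=
  gradient (fun x' : EVec dx => ell (epair θ x')) x

/-- `W` is a standard Wiener process in `ℝᵈ`: its coordinates are independent standard real
Brownian motions. -/
structure IsWienerProcess {Ω : Type*} [MeasurableSpace Ω] {d : ℕ}
    (W : ℝ≥0 → Ω → EVec d) (P : Measure Ω) : Prop where
  measurable : ∀ t, Measurable (W t)
  isBrownian : ∀ j : Fin d, IsBrownianReal (fun t ω => W t ω j) P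
  indep : iIndepFun (fun (j : Fin d) (ω : Ω) (t : ℝ≥0) => W t ω j) P

/-- The law of the pair `(X, U)`. -/
def pairLaw {Ω : Type*} [MeasurableSpace Ω] {d : ℕ} (P : Measure Ω) (X U : Ω → EVec d) :
    Measure (EPair d d) :=
  P.map (fun ω => epair (X ω) (U ω))

/-- `(θ, m, X, U)` solves the McKean--Vlasov system
`dθ = ηθ m dt`, `dm = [∫ ∇_θ ℓ(θ, x) q_{t,X}(dx) - γθ ηθ m] dt` with `q_{t,X} = Law(X_t)`,
`dX = ηx U dt`, `dU = [∇_x ℓ(θ, X) - γx ηx U] dt + √(2γx) dW`,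
on `[0, ∞)`, driven by the Wiener process `W`, with `(θ, m)(0) = (θ₀, m₀)` and
`Law(X_0, U_0) = q₀`, where `(X_0, U_0)` is independent of `W`.
The component `(θ, m)` is deterministic. The noise is additive, so the stochastic integral in the
integrated equation for `U` is `√(2γx) W_t`. -/
structure IsMeanFieldFlow {Ω : Type*} [MeasurableSpace Ω] {dθ dx : ℕ} (P : Measure Ω)
    (ell : EPair dθ dx → ℝ) (ηθ γθ ηx γx : ℝ)
    (θ₀ m₀ : EVec dθ) (q₀ : Measure (EPair dx dx))
    (W : ℝ≥0 → Ω → EVec dx) (θ m : ℝ≥0 → EVec dθ) (X U : ℝ≥0 → Ω → EVec dx) : Prop where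
  wiener : IsWienerProcess W P
  measurable_X : ∀ t, Measurable (X t)
  measurable_U : ∀ t, Measurable (U t)
  init_law : pairLaw P (X 0) (U 0) = q₀
  init_indep : IndepFun (fun ω => epair (X 0 ω) (U 0 ω)) (fun ω (t : ℝ≥0) => W t ω) P
  continuous_θ : Continuous θ
  continuous_m : Continuous m
  continuous_X : ∀ᵐ ω ∂P, Continuous (fun t => X t ω)
  continuous_U : ∀ᵐ ω ∂P, Continuous (fun t => U t ω)
  eq_θ : ∀ t : ℝ≥0, θ t = θ₀ + ∫ s in (0 : ℝ)..t, ηθ • m s.toNNReal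
  eq_m : ∀ t : ℝ≥0, m t = m₀ + ∫ s in (0 : ℝ)..t,
    ((∫ x, gradTheta ell (θ s.toNNReal) x ∂(P.map (X s.toNNReal)))
      - (γθ * ηθ) • m s.toNNReal)
  eq_X : ∀ᵐ ω ∂P, ∀ t : ℝ≥0, X t ω = X 0 ω + ∫ s in (0 : ℝ)..t, ηx • U s.toNNReal ω
  eq_U : ∀ᵐ ω ∂P, ∀ t : ℝ≥0, U t ω = U 0 ω
    + (∫ s in (0 : ℝ)..t,
        (gradX ell (θ s.toNNReal) (X s.toNNReal ω) - (γx * ηx) • U s.toNNReal ω))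
    + √(2 * γx) • W t ω

/-- `(θ, m, (X^i, U^i)_{i < M})` solves the `M`-particle system
`dθ = ηθ m dt`, `dm = [M⁻¹ ∑ i, ∇_θ ℓ(θ, X^i) - γθ ηθ m] dt`,
`dX^i = ηx U^i dt`, `dU^i = [∇_x ℓ(θ, X^i) - γx ηx U^i] dt + √(2γx) dW^i`,
on `[0, ∞)`, started at `(θ, m)(0) = (θ₀, m₀)`, where the pairs
`((X^i_0, U^i_0), W^i)`, `i < M`, are independent copies of an initial point of law `q₀` together
with an independent standard Wiener process. Here `(θ, m)` is random. -/
structure IsParticleSystem {Ω : Type*} [MeasurableSpace Ω] {dθ dx : ℕ} (M : ℕ) (P : Measure Ω)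
    (ell : EPair dθ dx → ℝ) (ηθ γθ ηx γx : ℝ)
    (θ₀ m₀ : EVec dθ) (q₀ : Measure (EPair dx dx))
    (W : Fin M → ℝ≥0 → Ω → EVec dx) (θ m : ℝ≥0 → Ω → EVec dθ)
    (X U : Fin M → ℝ≥0 → Ω → EVec dx) : Prop where
  wiener : ∀ i, IsWienerProcess (W i) P
  measurable_θ : ∀ t, Measurable (θ t)
  measurable_m : ∀ t, Measurable (m t)
  measurable_X : ∀ i t, Measurable (X i t)
  measurable_U : ∀ i t, Measurable (U i t)
  init_law : ∀ i, pairLaw P (X i 0) (U i 0) = q₀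
  init_indep : ∀ i, IndepFun (fun ω => epair (X i 0 ω) (U i 0 ω)) (fun ω (t : ℝ≥0) => W i t ω) P
  indep : iIndepFun
    (fun (i : Fin M) (ω : Ω) => (epair (X i 0 ω) (U i 0 ω), fun t : ℝ≥0 => W i t ω)) P
  continuous_θ : ∀ᵐ ω ∂P, Continuous (fun t => θ t ω)
  continuous_m : ∀ᵐ ω ∂P, Continuous (fun t => m t ω)
  continuous_X : ∀ i, ∀ᵐ ω ∂P, Continuous (fun t => X i t ω)
  continuous_U : ∀ i, ∀ᵐ ω ∂P, Continuous (fun t => U i t ω)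
  eq_θ : ∀ᵐ ω ∂P, ∀ t : ℝ≥0, θ t ω = θ₀ + ∫ s in (0 : ℝ)..t, ηθ • m s.toNNReal ω
  eq_m : ∀ᵐ ω ∂P, ∀ t : ℝ≥0, m t ω = m₀ + ∫ s in (0 : ℝ)..t,
    ((M : ℝ)⁻¹ • (∑ i, gradTheta ell (θ s.toNNReal ω) (X i s.toNNReal ω))
      - (γθ * ηθ) • m s.toNNReal ω)
  eq_X : ∀ i, ∀ᵐ ω ∂P, ∀ t : ℝ≥0,
    X i t ω = X i 0 ω + ∫ s in (0 : ℝ)..t, ηx • U i s.toNNReal ω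
  eq_U : ∀ i, ∀ᵐ ω ∂P, ∀ t : ℝ≥0, U i t ω = U i 0 ω
    + (∫ s in (0 : ℝ)..t,
        (gradX ell (θ s.toNNReal ω) (X i s.toNNReal ω) - (γx * ηx) • U i s.toNNReal ω))
    + √(2 * γx) • W i t ω

/-- The joint law of the `M` particles `((X^i, U^i))_{i < M}`, on the configuration space. -/
def particleLaw {Ω : Type*} [MeasurableSpace Ω] {d M : ℕ} (P : Measure Ω)
    (X U : Fin M → Ω → EVec d) : Measure (Fin M → EPair d d) :=
  P.map (fun ω i => epair (X i ω) (U i ω))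

/-- `π` is a coupling of `μ` and `ν`. -/
def IsTransportPlan {α : Type*} [MeasurableSpace α] (μ ν : Measure α) (π : Measure (α × α)) :
    Prop :=
  π.map Prod.fst = μ ∧ π.map Prod.snd = ν

/-- The squared Wasserstein-2 distance `W₂²(μ, ν)` between laws on the configuration space
`(ℝᵈ × ℝᵈ)^M`, where that space carries the normalized Euclidean distance of particle systems,
`dist(z, z')² = M⁻¹ ∑ i, ‖z i - z' i‖²`. Extended-valued. -/
def configW2Sq {d M : ℕ} (μ ν : Measure (Fin M → EPair d d)) : ℝ≥0∞ :=
  ⨅ (π : Measure ((Fin M → EPair d d) × (Fin M → EPair d d))) (_ : IsTransportPlan μ ν π),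
    ∫⁻ p, (∑ i, ‖p.1 i - p.2 i‖ₑ ^ 2) / (M : ℝ≥0∞) ∂π

end

/-! The argument is Sznitman's synchronous coupling. Along the mean-field flow `(θ, m)` is
deterministic, so once it is given, `(X, U)` solves a Lipschitz equation with time-dependent
coefficients and additive noise. On the probability space of the particles this equation is solved
`M` times, with the initial points and noises of the particles. The resulting copies `Y i` are
independent with law `q_t`; their joint law is the product measure, and pairing them with the
particles gives a coupling that bounds the Wasserstein term.

In the difference between copies and particles the initial points and the noises cancel. Besides
Lipschitz terms there remains one source: the fluctuation of the empirical parameter drift along the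
copies about its expectation. Grönwall (`mean_field_gronwall`, `coupling_pathwise_bound`) bounds all
differences on `[0, T]` by a constant times `D`, the time integral of the norm of this fluctuation.
By independence the fluctuation has second moment at most `S / M`
(`lintegral_enorm_sq_integral_sub_mean_le`), where `S` is finite because `q₀` has a second moment.
Hence the error is `O(1 / M)`.

The delicate point is that the flow and the particles live on different probability spaces, so the
law of `Y i` must be found by uniqueness in law. Additive noise allows the equation to be solved
path by path, and `tendsto_eulerScheme` shows that every solution is the limit of its Euler schemes.
So `pathSolution` is one measurable functional of the initial point and the noise path; it
transports both equality of laws and independence from the data to the solutions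
(`exists_mean_field_copies`). -/

/-! ### Grönwall inequalities -/

/-- **Grönwall's inequality**, integral form with a constant datum. -/
theorem le_mul_exp_of_le_add_integral {f : ℝ → ℝ} (hf : Continuous f) (hf0 : ∀ t, 0 ≤ f t)
    {a C T : ℝ} (hC : 0 ≤ C)
    (h : ∀ t ∈ Set.Icc 0 T, f t ≤ a + C * ∫ s in (0 : ℝ)..t, f s) :
    ∀ t ∈ Set.Icc 0 T, f t ≤ a * Real.exp (C * t) := by
  intro t ht
  have hder : ∀ x, HasDerivAt (fun t => a + C * ∫ s in (0 : ℝ)..t, f s) (C * f x) x := fun x =>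
    ((intervalIntegral.integral_hasDerivAt_right (hf.intervalIntegrable _ _)
      hf.stronglyMeasurable.stronglyMeasurableAtFilter hf.continuousAt).const_mul C).const_add a
  have ha : 0 ≤ a := by
    have := h 0 ⟨le_rfl, ht.1.trans ht.2⟩
    simp only [intervalIntegral.integral_same, mul_zero, add_zero] at this
    exact (hf0 0).trans this
  have key := norm_le_gronwallBound_of_norm_deriv_right_le (a := 0) (b := T) (δ := a) (K := C)
    (ε := 0) (f := fun t => a + C * ∫ s in (0 : ℝ)..t, f s) (f' := fun x => C * f x)
    (fun x _ => (hder x).continuousAt.continuousWithinAt) (fun x _ => (hder x).hasDerivWithinAt)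
    (by simp [abs_of_nonneg ha])
    (fun x hx => by
      have h1 := h x ⟨hx.1, hx.2.le⟩
      rw [Real.norm_of_nonneg (mul_nonneg hC (hf0 x)), Real.norm_of_nonneg ((hf0 x).trans h1)]
      simpa using mul_le_mul_of_nonneg_left h1 hC) t ht
  rw [gronwallBound_ε0, sub_zero] at key
  exact (h t ht).trans ((le_abs_self _).trans key)

/-- Stability of a system of finitely many integral inequalities coupled through their mean. -/
theorem mean_field_gronwall {M : ℕ} (hM : 0 < M) {a : ℝ → ℝ} {b : Fin M → ℝ → ℝ}
    (ha : Continuous a) (hb : ∀ i, Continuous (b i)) (ha0 : ∀ t, 0 ≤ a t) (hb0 : ∀ i t, 0 ≤ b i t)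
    {C D T : ℝ} (hC : 0 ≤ C) (hD : 0 ≤ D)
    (h1 : ∀ t ∈ Set.Icc 0 T, a t ≤ D + C * ∫ s in (0 : ℝ)..t, (a s + (M : ℝ)⁻¹ * ∑ i, b i s))
    (h2 : ∀ i, ∀ t ∈ Set.Icc 0 T, b i t ≤ C * ∫ s in (0 : ℝ)..t, (a s + b i s)) :
    ∀ t ∈ Set.Icc 0 T, a t ≤ (1 + C * T) * Real.exp (3 * C * T) * D ∧
      ∀ i, b i t ≤ (1 + C * T) * Real.exp (3 * C * T) * D := by
  have hMpos : (0 : ℝ) < M := by exact_mod_cast hM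
  set A : ℝ → ℝ := fun s => a s + (M : ℝ)⁻¹ * ∑ i, b i s with hA
  have hAc : Continuous A := by fun_prop
  have hbar0 : ∀ s, 0 ≤ (M : ℝ)⁻¹ * ∑ i, b i s := fun s =>
    mul_nonneg (by positivity) (Finset.sum_nonneg fun i _ => hb0 i s)
  have hA0 : ∀ s, 0 ≤ A s := fun s => add_nonneg (ha0 s) (hbar0 s)
  -- Averaging `h2` over the particles and adding `h1` closes the system in `A`; each of the two
  -- contributes `C`, hence the rate `2 * C`.
  have hAb : ∀ t ∈ Set.Icc 0 T, A t ≤ D * Real.exp (2 * C * t) := by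
    refine le_mul_exp_of_le_add_integral hAc hA0 (by positivity) fun t ht => ?_
    have hsum : (M : ℝ)⁻¹ * ∑ i, b i t ≤ C * ∫ s in (0 : ℝ)..t, A s := by
      have : ∑ i, b i t ≤ ∑ i, C * ∫ s in (0 : ℝ)..t, (a s + b i s) :=
        Finset.sum_le_sum fun i _ => h2 i t ht
      refine (mul_le_mul_of_nonneg_left this (by positivity)).trans (le_of_eq ?_)
      have hswap : ∑ i, ∫ s in (0 : ℝ)..t, (a s + b i s) = ∫ s in (0 : ℝ)..t, ∑ i, (a s + b i s) :=
        (intervalIntegral.integral_finsetSum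
          (fun i _ => (ha.add (hb i)).intervalIntegrable _ _)).symm
      rw [← Finset.mul_sum, hswap, mul_left_comm, ← intervalIntegral.integral_const_mul]
      congr 2
      ext s
      simp only [Finset.sum_add_distrib, Finset.sum_const, Finset.card_univ, Fintype.card_fin,
        nsmul_eq_mul, hA]
      field_simp
    have := h1 t ht
    change a t + _ ≤ _
    linarith
  have hexp : ∀ t ∈ Set.Icc 0 T, ∀ k : ℝ, 0 ≤ k → k ≤ 3 →
      Real.exp (k * C * t) ≤ Real.exp (3 * C * T) := by
    intro t ht k hk hk3
    apply Real.exp_le_exp.2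
    have := mul_le_mul_of_nonneg_left ht.2 hC
    have h3 : 0 ≤ C * T := (mul_nonneg hC (ht.1.trans ht.2))
    nlinarith [mul_nonneg hk (sub_nonneg.2 this), mul_nonneg (sub_nonneg.2 hk3) h3]
  intro t ht
  have hT : 0 ≤ T := ht.1.trans ht.2
  constructor
  · have h3 : a t ≤ D * Real.exp (3 * C * T) :=
      (le_add_of_nonneg_right (hbar0 t)).trans ((hAb t ht).trans
        (mul_le_mul_of_nonneg_left (hexp t ht 2 (by norm_num) (by norm_num)) hD))
    have h4 : 0 ≤ C * T * Real.exp (3 * C * T) * D := by positivity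
    linarith
  · intro i
    -- The mean does not control a single `b i`, but `h2` sees the other particles only through `a`,
    -- which is already bounded; a second Grönwall at rate `C` applies. The rates `2 * C` and `C`
    -- add up to the exponent `3 * C * T`.
    have hbi : ∀ t ∈ Set.Icc 0 T, b i t ≤ (C * T * (D * Real.exp (2 * C * T))) *
        Real.exp (C * t) := by
      refine le_mul_exp_of_le_add_integral (hb i) (hb0 i) hC fun t ht => ?_
      refine (h2 i t ht).trans ?_
      rw [intervalIntegral.integral_add (ha.intervalIntegrable _ _)
        ((hb i).intervalIntegrable _ _), mul_add, mul_assoc]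
      refine add_le_add_left (mul_le_mul_of_nonneg_left ?_ hC) _
      have : ∫ s in (0 : ℝ)..t, a s ≤ ∫ s in (0 : ℝ)..t, D * Real.exp (2 * C * T) := by
        refine intervalIntegral.integral_mono_on ht.1 (ha.intervalIntegrable _ _)
          (continuous_const.intervalIntegrable _ _) fun s hs => ?_
        have hs' : s ∈ Set.Icc 0 T := ⟨hs.1, hs.2.trans ht.2⟩
        refine (le_add_of_nonneg_right (hbar0 s)).trans ((hAb s hs').trans
          (mul_le_mul_of_nonneg_left (Real.exp_le_exp.2 ?_) hD))
        exact mul_le_mul_of_nonneg_left hs'.2 (by positivity)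
      refine this.trans ?_
      rw [intervalIntegral.integral_const, sub_zero, smul_eq_mul]
      exact mul_le_mul_of_nonneg_right ht.2 (by positivity)
    have h5 := hbi t ht
    have h6 : Real.exp (2 * C * T) * Real.exp (C * t) ≤ Real.exp (3 * C * T) := by
      rw [← Real.exp_add]
      apply Real.exp_le_exp.2
      have := mul_le_mul_of_nonneg_left ht.2 hC
      linarith
    have h7 : C * T * (D * Real.exp (2 * C * T)) * Real.exp (C * t)
        ≤ C * T * D * Real.exp (3 * C * T) := by
      have := mul_le_mul_of_nonneg_left h6 (by positivity : 0 ≤ C * T * D)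
      linarith
    have h8 : 0 ≤ Real.exp (3 * C * T) * D := by positivity
    linarith

/-! ### Lipschitz Volterra equations: Picard iteration and Euler scheme -/

/-- A Lipschitz Volterra equation with continuous forcing has a solution on every compact
interval. -/
theorem exists_integral_eq_of_lipschitz {E : Type*} [NormedAddCommGroup E] [NormedSpace ℝ E]
    [CompleteSpace E] {F : ℝ → E → E} (hF : Continuous (Function.uncurry F)) {C : ℝ≥0}
    (hL : ∀ s, LipschitzWith C (F s)) {n : ℝ → E} (hn : Continuous n) {T : ℝ} (hT : 0 ≤ T) :
    ∃ z : ℝ → E, Continuous z ∧ ∀ t ∈ Set.Icc 0 T, z t = n t + ∫ s in (0 : ℝ)..t, F s (z s) := by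
  -- In the supremum norm weighted by `exp (-lam * t)` the Picard map has Lipschitz constant at most
  -- `C / lam`, so any `lam > C` gives a contraction on the whole interval, however large `T` is.
  set lam : ℝ := C + 1 with hlam
  have hlam0 : 0 < lam := by positivity
  -- the Picard map for `y t = exp (-lam * t) • z t`
  have hcomp : ∀ y : C(Set.Icc 0 T, E), Continuous fun s : ℝ =>
      F s (Real.exp (lam * s) • Set.IccExtend hT y s) := fun y =>
    hF.comp (continuous_id.prodMk ((by fun_prop : Continuous fun s : ℝ => Real.exp (lam * s)).smul
      (y.continuous.Icc_extend')))
  let Ψ : C(Set.Icc 0 T, E) → C(Set.Icc 0 T, E) := fun y =>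
    ⟨fun t => Real.exp (-lam * t) •
      (n t + ∫ s in (0 : ℝ)..t, F s (Real.exp (lam * s) • Set.IccExtend hT y s)), by
      have h1 : Continuous fun t : ℝ =>
        ∫ s in (0 : ℝ)..t, F s (Real.exp (lam * s) • Set.IccExtend hT y s) :=
        intervalIntegral.continuous_primitive (fun _ _ => (hcomp y).intervalIntegrable _ _) 0
      have h2 : Continuous fun t : ℝ => Real.exp (-lam * t) •
        (n t + ∫ s in (0 : ℝ)..t, F s (Real.exp (lam * s) • Set.IccExtend hT y s)) :=
        (by fun_prop : Continuous fun t : ℝ => Real.exp (-lam * t)).smul (hn.add h1)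
      exact h2.comp continuous_subtype_val⟩
  have hk : (C / (C + 1) : ℝ≥0) < 1 := by
    rw [div_lt_one (by positivity)]; exact lt_add_one C
  have hΨ : ContractingWith (C / (C + 1)) Ψ := by
    refine ⟨hk, LipschitzWith.of_dist_le_mul fun y y' => ?_⟩
    rw [ContinuousMap.dist_le (by positivity)]
    intro t
    have hI := (hcomp y).intervalIntegrable (μ := volume) 0 (t : ℝ)
    have hI' := (hcomp y').intervalIntegrable (μ := volume) 0 (t : ℝ)
    simp only [Ψ, ContinuousMap.coe_mk]
    rw [dist_eq_norm, ← smul_sub, add_sub_add_left_eq_sub,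
      ← intervalIntegral.integral_sub hI hI', norm_smul, Real.norm_of_nonneg (Real.exp_pos _).le]
    have hb : ‖∫ s in (0 : ℝ)..t, (F s (Real.exp (lam * s) • Set.IccExtend hT y s)
        - F s (Real.exp (lam * s) • Set.IccExtend hT y' s))‖
        ≤ ∫ s in (0 : ℝ)..t, (C * dist y y') * Real.exp (lam * s) := by
      refine intervalIntegral.norm_integral_le_of_norm_le t.2.1 (ae_of_all _ fun s _ => ?_)
        ((by fun_prop : Continuous fun s : ℝ =>
          (C * dist y y') * Real.exp (lam * s)).intervalIntegrable _ _)
      rw [← dist_eq_norm]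
      refine ((hL s).dist_le_mul _ _).trans ?_
      rw [dist_eq_norm, ← smul_sub, norm_smul, Real.norm_of_nonneg (Real.exp_pos _).le,
        ← dist_eq_norm, mul_assoc, mul_comm (dist y y')]
      gcongr
      exact ContinuousMap.dist_apply_le_dist _
    have hint : ∫ s in (0 : ℝ)..t, (C * dist y y') * Real.exp (lam * s)
        = (C * dist y y') * ((Real.exp (lam * t) - 1) / lam) := by
      rw [intervalIntegral.integral_const_mul,
        intervalIntegral.integral_comp_mul_left (fun x => Real.exp x) hlam0.ne', integral_exp]
      simp [div_eq_inv_mul]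
    refine (mul_le_mul_of_nonneg_left (hb.trans hint.le) (Real.exp_pos _).le).trans ?_
    have he : Real.exp (-lam * t) * Real.exp (lam * t) = 1 := by
      rw [← Real.exp_add]; simp
    have hfrac : Real.exp (-lam * t) * ((Real.exp (lam * t) - 1) / lam) ≤ 1 / lam := by
      rw [← mul_div_assoc, mul_sub, he]
      gcongr
      linarith [Real.exp_pos (-lam * t)]
    calc Real.exp (-lam * t) * (C * dist y y' * ((Real.exp (lam * t) - 1) / lam))
        = (C * dist y y') * (Real.exp (-lam * t) * ((Real.exp (lam * t) - 1) / lam)) := by ring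
      _ ≤ (C * dist y y') * (1 / lam) := mul_le_mul_of_nonneg_left hfrac (by positivity)
      _ = ((C / (C + 1) : ℝ≥0) : ℝ) * dist y y' := by
        rw [hlam]; push_cast; ring
  have : Nonempty C(Set.Icc 0 T, E) := ⟨0⟩
  set y := hΨ.fixedPoint Ψ
  have hy : Ψ y = y := hΨ.fixedPoint_isFixedPt
  refine ⟨fun t => Real.exp (lam * t) • Set.IccExtend hT y t,
    (by fun_prop : Continuous fun s : ℝ => Real.exp (lam * s)).smul y.continuous.Icc_extend',
    fun t ht => ?_⟩
  have h1 := congrArg (fun g : C(Set.Icc 0 T, E) => g ⟨t, ht⟩) hy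
  simp only [Ψ, ContinuousMap.coe_mk] at h1
  simp only
  rw [Set.IccExtend_of_mem hT y ht, ← h1, smul_smul, ← Real.exp_add]
  simp

/-- The explicit Euler scheme with step `h` for `z t = n t + ∫ s in 0..t, F s (z s)`. -/
noncomputable def eulerScheme {E : Type*} [NormedAddCommGroup E] [NormedSpace ℝ E]
    (F : ℝ → E → E) (n : ℝ → E) (h : ℝ) : ℕ → E
  | 0 => n 0
  | k + 1 => eulerScheme F n h k + (n ((k + 1 : ℕ) * h) - n (k * h))
      + h • F (k * h) (eulerScheme F n h k)

/-- The Euler scheme converges to the solution. -/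
theorem tendsto_eulerScheme {E : Type*} [NormedAddCommGroup E] [NormedSpace ℝ E]
    [CompleteSpace E] {F : ℝ → E → E} (hF : Continuous (Function.uncurry F)) {C : ℝ≥0}
    (hL : ∀ s, LipschitzWith C (F s)) {n z : ℝ → E} (hz : Continuous z) {t : ℝ} (ht : 0 ≤ t)
    (h : ∀ r ∈ Set.Icc 0 t, z r = n r + ∫ s in (0 : ℝ)..r, F s (z s)) :
    Tendsto (fun N : ℕ => eulerScheme F n (t / N) N) atTop (𝓝 (z t)) := by
  have hG : Continuous fun s => F s (z s) := hF.comp (continuous_id.prodMk hz)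
  have huc := isCompact_Icc.uniformContinuousOn_of_continuous (hG.continuousOn (s := Set.Icc 0 t))
  rw [Metric.tendsto_atTop]
  intro ε hε
  -- If the drift along `z` varies by at most `ε / B` during one step, the accumulated error is at
  -- most `t * exp (C * t) * (ε / B)`. The `+ 1` makes this strictly less than `ε` and keeps `B`
  -- positive at `t = 0`.
  set B : ℝ := t * Real.exp (C * t) + 1 with hB
  have hB0 : 0 < B := by positivity
  obtain ⟨δ, hδ, hδ'⟩ := Metric.uniformContinuousOn_iff.1 huc (ε / B) (by positivity)
  obtain ⟨N₀, hN₀⟩ := exists_nat_gt (t / δ)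
  refine ⟨N₀ + 1, fun N hN => ?_⟩
  have hNpos : (0 : ℝ) < N := by
    have : 0 < N := by omega
    exact_mod_cast this
  set τ := t / N with hτ
  have hτ0 : 0 ≤ τ := by positivity
  have hNτ : N * τ = t := by rw [hτ]; field_simp
  have hτδ : τ < δ := by
    rw [hτ, div_lt_iff₀ hNpos]
    rw [div_lt_iff₀ hδ] at hN₀
    have : (N₀ : ℝ) ≤ N := by exact_mod_cast (by omega : N₀ ≤ N)
    nlinarith
  have hrange : ∀ k ≤ N, (k : ℝ) * τ ∈ Set.Icc 0 t := fun k hk =>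
    ⟨by positivity, by
      rw [← hNτ]; exact mul_le_mul_of_nonneg_right (by exact_mod_cast hk) hτ0⟩
  -- error recursion
  have hrec : ∀ k < N, ‖z ((k + 1 : ℕ) * τ) - eulerScheme F n τ (k + 1)‖
      ≤ (1 + C * τ) * ‖z (k * τ) - eulerScheme F n τ k‖ + τ * (ε / B) := by
    intro k hk
    have hk1 := hrange (k + 1) hk
    have hk0 := hrange k hk.le
    have hle : (k : ℝ) * τ ≤ (k + 1 : ℕ) * τ := by push_cast; nlinarith
    have hlen : ((k + 1 : ℕ) : ℝ) * τ - k * τ = τ := by push_cast; ring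
    have hI : ∫ s in (k * τ)..((k + 1 : ℕ) * τ), (F s (z s) - F (k * τ) (z (k * τ)))
        = (∫ s in (0 : ℝ)..((k + 1 : ℕ) * τ), F s (z s)) - (∫ s in (0 : ℝ)..(k * τ), F s (z s))
          - τ • F (k * τ) (z (k * τ)) := by
      rw [intervalIntegral.integral_sub (hG.intervalIntegrable _ _)
        (continuous_const.intervalIntegrable _ _), intervalIntegral.integral_const, hlen,
        intervalIntegral.integral_interval_sub_left (hG.intervalIntegrable _ _)
          (hG.intervalIntegrable _ _)]
    have hIb : ‖∫ s in (k * τ)..((k + 1 : ℕ) * τ), (F s (z s) - F (k * τ) (z (k * τ)))‖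
        ≤ (ε / B) * |(k + 1 : ℕ) * τ - k * τ| := by
      refine intervalIntegral.norm_integral_le_of_norm_le_const fun s hs => ?_
      rw [Set.uIoc_of_le hle] at hs
      rw [← dist_eq_norm]
      refine (hδ' s ⟨hk0.1.trans hs.1.le, hs.2.trans hk1.2⟩ _ hk0 ?_).le
      rw [Real.dist_eq, abs_of_nonneg (by linarith [hs.1])]
      linarith [hs.2]
    rw [hlen, abs_of_nonneg hτ0] at hIb
    -- The scheme takes the increments of `n` exactly, so they cancel: the local error involves only
    -- the oscillation of `s ↦ F s (z s)`, never the roughness of the driving path.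
    have hdecomp : z ((k + 1 : ℕ) * τ) - eulerScheme F n τ (k + 1)
        = (z (k * τ) - eulerScheme F n τ k)
          + τ • (F (k * τ) (z (k * τ)) - F (k * τ) (eulerScheme F n τ k))
          + ∫ s in (k * τ)..((k + 1 : ℕ) * τ), (F s (z s) - F (k * τ) (z (k * τ))) := by
      rw [hI, h _ hk1, eulerScheme, smul_sub]
      have := h _ hk0
      rw [show (∫ s in (0 : ℝ)..(k * τ), F s (z s)) = z (k * τ) - n (k * τ) by
        rw [this]; abel]
      abel
    rw [hdecomp]
    refine (norm_add_le _ _).trans ?_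
    have h2 : ‖τ • (F (k * τ) (z (k * τ)) - F (k * τ) (eulerScheme F n τ k))‖
        ≤ C * τ * ‖z (k * τ) - eulerScheme F n τ k‖ := by
      rw [norm_smul, Real.norm_of_nonneg hτ0, mul_comm (C : ℝ), mul_assoc]
      have := (hL (k * τ)).dist_le_mul (z (k * τ)) (eulerScheme F n τ k)
      rw [dist_eq_norm, dist_eq_norm] at this
      exact mul_le_mul_of_nonneg_left this hτ0
    have h3 := norm_add_le (z (k * τ) - eulerScheme F n τ k)
      (τ • (F (k * τ) (z (k * τ)) - F (k * τ) (eulerScheme F n τ k)))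
    linarith
  -- Discrete Grönwall: `k` local errors, each amplified by at most `exp (C * (k * τ))`.
  have herr : ∀ k ≤ N, ‖z (k * τ) - eulerScheme F n τ k‖
      ≤ k * τ * (ε / B) * Real.exp (C * (k * τ)) := by
    intro k
    induction k with
    | zero =>
      intro _
      have := h 0 ⟨le_rfl, ht⟩
      simp [eulerScheme, this]
    | succ k ih =>
      intro hk
      refine (hrec k hk).trans ?_
      have ih' := ih (by omega)
      have h1 : 1 + C * τ ≤ Real.exp (C * τ) := by
        have := Real.add_one_le_exp (C * τ); linarith
      have h2 : Real.exp (C * ((k + 1 : ℕ) * τ)) = Real.exp (C * τ) * Real.exp (C * (k * τ)) := by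
        rw [← Real.exp_add]; congr 1; push_cast; ring
      have h3 : 1 ≤ Real.exp (C * τ) * Real.exp (C * (k * τ)) := by
        rw [← h2]; exact Real.one_le_exp (by positivity)
      have h4 : (1 + C * τ) * ‖z (k * τ) - eulerScheme F n τ k‖
          ≤ Real.exp (C * τ) * (k * τ * (ε / B) * Real.exp (C * (k * τ))) :=
        mul_le_mul h1 ih' (norm_nonneg _) (Real.exp_pos _).le
      have h5 : τ * (ε / B) * 1 ≤ τ * (ε / B) * (Real.exp (C * τ) * Real.exp (C * (k * τ))) :=
        mul_le_mul_of_nonneg_left h3 (by positivity)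
      rw [h2]
      push_cast
      linarith
  have hfin := herr N le_rfl
  rw [hNτ] at hfin
  rw [dist_comm, dist_eq_norm]
  refine hfin.trans_lt ?_
  calc t * (ε / B) * Real.exp (C * t) = ε * (t * Real.exp (C * t) / B) := by ring
    _ < ε * 1 := by
      apply mul_lt_mul_of_pos_left _ hε
      rw [div_lt_one hB0]; linarith
    _ = ε := mul_one ε

/-! ### Laws of Wiener processes -/

/-- Two standard Wiener processes have the same law on path space. -/
theorem IsWienerProcess.map_eq {Ω Ω' : Type*} [MeasurableSpace Ω] [MeasurableSpace Ω'] {d : ℕ}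
    {W : ℝ≥0 → Ω → EVec d} {P : Measure Ω} [IsProbabilityMeasure P]
    {W' : ℝ≥0 → Ω' → EVec d} {P' : Measure Ω'} [IsProbabilityMeasure P']
    (h : IsWienerProcess W P) (h' : IsWienerProcess W' P') :
    P.map (fun ω t => W t ω) = P'.map (fun ω t => W' t ω) := by
  have hm : ∀ (j : Fin d), Measurable (fun (ω : Ω) (t : ℝ≥0) => W t ω j) := fun j =>
    measurable_pi_lambda _ fun t => by have := h.measurable t; fun_prop
  have hm' : ∀ (j : Fin d), Measurable (fun (ω : Ω') (t : ℝ≥0) => W' t ω j) := fun j =>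
    measurable_pi_lambda _ fun t => by have := h'.measurable t; fun_prop
  have hcoord : ∀ j : Fin d, P.map (fun (ω : Ω) (t : ℝ≥0) => W t ω j)
      = P'.map (fun (ω : Ω') (t : ℝ≥0) => W' t ω j) := by
    intro j
    -- A law on the product σ-algebra of paths is determined by its finite-dimensional marginals,
    -- which are the same Gaussian family for both processes.
    refine IsProjectiveLimit.unique (P := BrownianReal.projectiveFamily) (fun I => ?_) fun I => ?_
    · rw [Measure.map_map (by fun_prop) (hm j)]
      exact ((h.isBrownian j).toIsPreBrownianReal.hasLaw I).map_eq
    · rw [Measure.map_map (by fun_prop) (hm' j)]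
      exact ((h'.isBrownian j).toIsPreBrownianReal.hasLaw I).map_eq
  have h1 := (iIndepFun_iff_map_fun_eq_pi_map (fun j => (hm j).aemeasurable)).1 h.indep
  have h2 := (iIndepFun_iff_map_fun_eq_pi_map (fun j => (hm' j).aemeasurable)).1 h'.indep
  have h3 : P.map (fun ω j (t : ℝ≥0) => W t ω j) = P'.map (fun ω j (t : ℝ≥0) => W' t ω j) := by
    rw [h1, h2]; simp_rw [hcoord]
  let S : (Fin d → ℝ≥0 → ℝ) → ℝ≥0 → EVec d := fun f t => WithLp.toLp 2 fun j => f j t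
  have hS : Measurable S := measurable_pi_lambda _ fun t =>
    (WithLp.measurable_toLp 2 _).comp (by fun_prop)
  have h4 := congrArg (Measure.map S) h3
  rwa [Measure.map_map hS (measurable_pi_lambda _ hm),
    Measure.map_map hS (measurable_pi_lambda _ hm')] at h4

theorem IsWienerProcess.lintegral_enorm_sq {Ω : Type*} [MeasurableSpace Ω] {d : ℕ}
    {W : ℝ≥0 → Ω → EVec d} {P : Measure Ω} [IsProbabilityMeasure P]
    (h : IsWienerProcess W P) (t : ℝ≥0) : ∫⁻ ω, ‖W t ω‖ₑ ^ 2 ∂P = d * t := by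
  have hcoord : ∀ j : Fin d, ∫⁻ ω, ‖W t ω j‖ₑ ^ 2 ∂P = t := by
    intro j
    have hlaw := (h.isBrownian j).toIsPreBrownianReal.hasLaw_eval t
    have hv : evariance (fun ω => W t ω j) P = t := by
      rw [← hlaw.hasGaussianLaw.memLp_two.ofReal_variance_eq, hlaw.variance_eq,
        variance_id_gaussianReal]
      simp
    have hmean := (h.isBrownian j).toIsPreBrownianReal.integral_eval t
    rw [← hv, evariance]
    simp [hmean]
  have hsq : ∀ v : EVec d, ‖v‖ₑ ^ 2 = ∑ j, ‖v j‖ₑ ^ 2 := by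
    intro v
    have := EuclideanSpace.norm_sq_eq v
    simp only [← ofReal_norm, ← ENNReal.ofReal_pow (norm_nonneg _)]
    rw [this, ENNReal.ofReal_sum_of_nonneg fun _ _ => by positivity]
  simp_rw [hsq]
  rw [lintegral_finsetSum]
  · simp [hcoord]
  · intro j _
    have := h.measurable t
    fun_prop

/-- The law of an initial point together with an independent Wiener process is determined by the
law of the initial point. -/
theorem map_prodMk_wiener_eq {Ω Ω' E : Type*} [MeasurableSpace Ω] [MeasurableSpace Ω']
    [MeasurableSpace E] {d : ℕ}
    {W : ℝ≥0 → Ω → EVec d} {P : Measure Ω} [IsProbabilityMeasure P]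
    {W' : ℝ≥0 → Ω' → EVec d} {P' : Measure Ω'} [IsProbabilityMeasure P']
    (h : IsWienerProcess W P) (h' : IsWienerProcess W' P')
    {z : Ω → E} {z' : Ω' → E} (hz : Measurable z) (hz' : Measurable z')
    (hlaw : P.map z = P'.map z')
    (hi : IndepFun z (fun ω t => W t ω) P) (hi' : IndepFun z' (fun ω t => W' t ω) P') :
    P.map (fun ω => (z ω, fun t => W t ω)) = P'.map (fun ω => (z' ω, fun t => W' t ω)) := by
  rw [(indepFun_iff_map_prod_eq_prod_map_map hz.aemeasurable
      (measurable_pi_lambda _ h.measurable).aemeasurable).1 hi,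
    (indepFun_iff_map_prod_eq_prod_map_map hz'.aemeasurable
      (measurable_pi_lambda _ h'.measurable).aemeasurable).1 hi', hlaw, h.map_eq h']

/-! ### The solution as a measurable functional of the data -/

section PathSolution

variable {E E' : Type*} [NormedAddCommGroup E] [NormedSpace ℝ E]

/-- The solution at time `t` of `z t = x + J (w t) + ∫ s in 0..t, F s (z s)`, as a function of the
initial point `x` and of the driving path `w`. -/
noncomputable def pathSolution (F : ℝ → E → E) (J : E' → E) (t : ℝ) (p : E × (ℝ≥0 → E')) : E :=
  limUnder atTop fun N : ℕ => eulerScheme F (fun s => p.1 + J (p.2 s.toNNReal)) (t / N) N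

/-- Each Euler scheme reads the path at finitely many times, so it is measurable for the product
σ-algebra, and so is the limit; where the schemes diverge, `limUnder` takes a fixed default value.
-/
theorem measurable_pathSolution [CompleteSpace E] [SecondCountableTopology E] [MeasurableSpace E]
    [BorelSpace E] [MeasurableSpace E'] {F : ℝ → E → E} (hF : ∀ s, Measurable (F s)) {J : E' → E}
    (hJ : Measurable J) (t : ℝ) : Measurable (pathSolution F J t) := by
  have hmeas : ∀ (h : ℝ) (k : ℕ), Measurable fun p : E × (ℝ≥0 → E') =>
      eulerScheme F (fun s => p.1 + J (p.2 s.toNNReal)) h k := by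
    intro h k
    induction k with
    | zero => simp only [eulerScheme]; fun_prop
    | succ k ih =>
      simp only [eulerScheme]
      exact (ih.add (by fun_prop)).add (((hF _).comp ih).const_smul h)
  exact (StronglyMeasurable.limUnder fun N => (hmeas _ N).stronglyMeasurable).measurable

/-- Pathwise uniqueness in functional form: solutions on different probability spaces are values of
the same functional, so equal laws of the data force equal laws of the solutions. -/
theorem pathSolution_eq [CompleteSpace E] {F : ℝ → E → E}
    (hF : Continuous (Function.uncurry F)) {C : ℝ≥0}
    (hL : ∀ s, LipschitzWith C (F s)) {J : E' → E} {x : E} {w : ℝ≥0 → E'} {z : ℝ → E}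
    (hz : Continuous z) {t : ℝ} (ht : 0 ≤ t)
    (h : ∀ r ∈ Set.Icc 0 t, z r = x + J (w r.toNNReal) + ∫ s in (0 : ℝ)..r, F s (z s)) :
    pathSolution F J t (x, w) = z t :=
  (tendsto_eulerScheme hF hL hz ht h).limUnder_eq

end PathSolution

/-- A process with almost surely continuous paths is indistinguishable from a jointly measurable
process with continuous paths. -/
theorem exists_continuous_modification {Ω E : Type*} [MeasurableSpace Ω] {P : Measure Ω}
    [NormedAddCommGroup E] [MeasurableSpace E] [BorelSpace E] {Z : ℝ → Ω → E}
    (hm : ∀ t, Measurable (Z t)) (hc : ∀ᵐ ω ∂P, Continuous fun t => Z t ω) :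
    ∃ Z' : ℝ → Ω → E, Measurable (Function.uncurry Z') ∧ (∀ ω, Continuous fun t => Z' t ω) ∧
      ∀ᵐ ω ∂P, ∀ t, Z' t ω = Z t ω := by
  classical
  -- The set of discontinuous paths need not be measurable. It is enclosed in a measurable null set,
  -- on which the process is set to zero; joint measurability then follows from continuity in time.
  obtain ⟨s, hs, hsm, hs0⟩ := exists_measurable_superset_of_null (ae_iff.1 hc)
  have hcont : ∀ ω, Continuous fun t => s.indicator (fun _ => (0 : E)) ω +
      sᶜ.indicator (Z t) ω := by
    intro ω
    by_cases hω : ω ∈ s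
    · simpa [hω] using continuous_const
    · have : Continuous fun t => Z t ω := by
        by_contra h; exact hω (hs h)
      simpa [hω] using this
  refine ⟨fun t => sᶜ.indicator (Z t), ?_, fun ω => by simpa using hcont ω, ?_⟩
  · exact measurable_uncurry_of_continuous_of_measurable (fun ω => by simpa using hcont ω)
      fun t => (hm t).indicator hsm.compl
  · have : ∀ᵐ ω ∂P, ω ∉ s := by rw [ae_iff]; simpa using hs0
    filter_upwards [this] with ω hω t
    simp [hω]

/-! ### Second moments -/

/-- The Cauchy--Schwarz inequality against the constant `1`. -/
theorem sq_lintegral_le {α : Type*} [MeasurableSpace α] {μ : Measure α} {f : α → ℝ≥0∞}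
    (hf : AEMeasurable f μ) : (∫⁻ x, f x ∂μ) ^ 2 ≤ (∫⁻ x, f x ^ 2 ∂μ) * μ Set.univ := by
  have h := ENNReal.lintegral_mul_le_Lp_mul_Lq μ Real.HolderConjugate.two_two hf
    (aemeasurable_const (b := (1 : ℝ≥0∞)))
  simp only [Pi.mul_apply, mul_one, lintegral_const, ENNReal.rpow_two] at h
  refine (pow_le_pow_left₀ zero_le h 2).trans (le_of_eq ?_)
  rw [mul_pow, ← ENNReal.rpow_two, ← ENNReal.rpow_two, ← ENNReal.rpow_mul, ← ENNReal.rpow_mul]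
  norm_num

/-- Second moment of a time integral. -/
theorem lintegral_sq_lintegral_Icc_le {Ω : Type*} [MeasurableSpace Ω] {P : Measure Ω} [SFinite P]
    {f : ℝ → Ω → ℝ≥0∞} (hf : Measurable (Function.uncurry f)) {T : ℝ} {V : ℝ≥0∞}
    (hV : ∀ s ∈ Set.Icc 0 T, ∫⁻ ω, f s ω ^ 2 ∂P ≤ V) :
    ∫⁻ ω, (∫⁻ s in Set.Icc 0 T, f s ω) ^ 2 ∂P ≤ V * ENNReal.ofReal T ^ 2 := by
  have hvol : (volume.restrict (Set.Icc 0 T)) Set.univ = ENNReal.ofReal T := by simp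
  calc ∫⁻ ω, (∫⁻ s in Set.Icc 0 T, f s ω) ^ 2 ∂P
      ≤ ∫⁻ ω, (∫⁻ s in Set.Icc 0 T, f s ω ^ 2) * ENNReal.ofReal T ∂P :=
        lintegral_mono fun ω => by
          rw [← hvol]
          exact sq_lintegral_le (hf.comp measurable_prodMk_right).aemeasurable
    _ = (∫⁻ ω, (∫⁻ s in Set.Icc 0 T, f s ω ^ 2) ∂P) * ENNReal.ofReal T :=
        lintegral_mul_const' _ _ ENNReal.ofReal_ne_top
    _ = (∫⁻ s in Set.Icc 0 T, ∫⁻ ω, f s ω ^ 2 ∂P) * ENNReal.ofReal T := by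
        rw [lintegral_lintegral_swap]
        exact ((hf.comp measurable_swap).pow_const 2).aemeasurable
    _ ≤ (∫⁻ _ in Set.Icc 0 T, V) * ENNReal.ofReal T := by
        gcongr ?_ * _
        exact setLIntegral_mono measurable_const hV
    _ = V * ENNReal.ofReal T ^ 2 := by
        rw [lintegral_const, hvol, mul_assoc, sq]

theorem ENNReal.add_sq_le_two_mul (a b : ℝ≥0∞) : (a + b) ^ 2 ≤ 2 * (a ^ 2 + b ^ 2) := by
  have := ENNReal.rpow_add_le_mul_rpow_add_rpow a b (p := 2) (by norm_num)
  norm_num at this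
  exact this

/-- A priori bound for a Lipschitz Volterra equation. -/
theorem norm_le_of_integral_eq {E : Type*} [NormedAddCommGroup E] [NormedSpace ℝ E]
    {F : ℝ → E → E} {C : ℝ≥0} (hL : ∀ s, LipschitzWith C (F s)) {n z : ℝ → E}
    (hn : Continuous n) (hz : Continuous z) {B T : ℝ}
    (hB : ∀ s ∈ Set.Icc 0 T, ‖F s 0‖ ≤ B)
    (h : ∀ t ∈ Set.Icc 0 T, z t = n t + ∫ s in (0 : ℝ)..t, F s (z s)) :
    ∀ t ∈ Set.Icc 0 T,
      ‖z t‖ ≤ ‖n t‖ + (B * T + C * ∫ s in (0 : ℝ)..T, ‖n s‖) * Real.exp (C * T) := by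
  intro t ht
  have hT : 0 ≤ T := ht.1.trans ht.2
  have hB0 : 0 ≤ B := (norm_nonneg _).trans (hB t ht)
  have hnI : 0 ≤ ∫ s in (0 : ℝ)..T, ‖n s‖ :=
    intervalIntegral.integral_nonneg hT fun _ _ => norm_nonneg _
  -- Grönwall is applied to `z - n` rather than to `z`, so that `n` enters only at time `t` and
  -- through its time integral. Second moments at fixed times then suffice, and no maximal
  -- inequality for the noise is needed.
  have key := le_mul_exp_of_le_add_integral (f := fun t => ‖z t - n t‖)
    (a := B * T + C * ∫ s in (0 : ℝ)..T, ‖n s‖) (C := C) (T := T) (by fun_prop)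
    (fun _ => norm_nonneg _) C.2 ?_ t ht
  · have h1 : ‖z t‖ ≤ ‖n t‖ + ‖z t - n t‖ := by
      simpa using norm_add_le (n t) (z t - n t)
    have h2 : Real.exp (C * t) ≤ Real.exp (C * T) :=
      Real.exp_le_exp.2 (mul_le_mul_of_nonneg_left ht.2 C.2)
    have h3 := mul_le_mul_of_nonneg_left h2
      (by positivity : 0 ≤ B * T + C * ∫ s in (0 : ℝ)..T, ‖n s‖)
    linarith
  · intro t ht
    have h1 : z t - n t = ∫ s in (0 : ℝ)..t, F s (z s) := by rw [h t ht]; abel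
    have h2 : ‖z t - n t‖ ≤ ∫ s in (0 : ℝ)..t, (B + C * ‖n s‖ + C * ‖z s - n s‖) := by
      rw [h1]
      refine intervalIntegral.norm_integral_le_of_norm_le ht.1 (ae_of_all _ fun s hs => ?_)
        ((by fun_prop : Continuous fun s => B + C * ‖n s‖ + C * ‖z s - n s‖).intervalIntegrable _ _)
      have h3 := (hL s).dist_le_mul (z s) 0
      rw [dist_eq_norm, dist_eq_norm, sub_zero] at h3
      have h4 := norm_le_norm_add_norm_sub' (F s (z s)) (F s 0)
      have h5 := hB s ⟨hs.1.le, hs.2.trans ht.2⟩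
      have h6 := mul_le_mul_of_nonneg_left (norm_le_norm_add_norm_sub' (z s) (n s)) C.2
      simp only [NNReal.val_eq_coe] at h6
      linarith
    refine h2.trans ?_
    rw [intervalIntegral.integral_add
      ((by fun_prop : Continuous fun s => B + C * ‖n s‖).intervalIntegrable _ _)
      ((by fun_prop : Continuous fun s => C * ‖z s - n s‖).intervalIntegrable _ _),
      intervalIntegral.integral_const_mul]
    refine add_le_add_left ?_ _
    rw [intervalIntegral.integral_add (intervalIntegrable_const)
      ((by fun_prop : Continuous fun s => C * ‖n s‖).intervalIntegrable _ _),
      intervalIntegral.integral_const_mul, intervalIntegral.integral_const, sub_zero, smul_eq_mul,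
      mul_comm t]
    have h7 : ∫ s in (0 : ℝ)..t, ‖n s‖ ≤ ∫ s in (0 : ℝ)..T, ‖n s‖ :=
      intervalIntegral.integral_mono_interval le_rfl ht.1 ht.2 (ae_of_all _ fun _ => norm_nonneg _)
        (hn.norm.intervalIntegrable _ _)
    have h8 := ht.2
    gcongr

/-- The solution of a Lipschitz Volterra equation driven by a process with bounded second moments
has bounded second moments. -/
theorem exists_lintegral_enorm_sq_le {Ω E : Type*} [MeasurableSpace Ω] {P : Measure Ω}
    [IsProbabilityMeasure P] [NormedAddCommGroup E] [NormedSpace ℝ E] [MeasurableSpace E]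
    [BorelSpace E]
    {F : ℝ → E → E} (hF : Continuous (Function.uncurry F)) {C : ℝ≥0}
    (hL : ∀ s, LipschitzWith C (F s)) {n Z : ℝ → Ω → E}
    (hnm : ∀ t, Measurable (n t)) (hnc : ∀ᵐ ω ∂P, Continuous fun t => n t ω)
    (hZc : ∀ᵐ ω ∂P, Continuous fun t => Z t ω) {T : ℝ} (hT : 0 ≤ T) {R : ℝ≥0∞} (hR : R < ∞)
    (hn2 : ∀ t ∈ Set.Icc 0 T, ∫⁻ ω, ‖n t ω‖ₑ ^ 2 ∂P ≤ R)
    (h : ∀ᵐ ω ∂P, ∀ t ∈ Set.Icc 0 T, Z t ω = n t ω + ∫ s in (0 : ℝ)..t, F s (Z s ω)) :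
    ∃ S : ℝ≥0∞, S < ∞ ∧ ∀ t ∈ Set.Icc 0 T, ∫⁻ ω, ‖Z t ω‖ₑ ^ 2 ∂P ≤ S := by
  obtain ⟨B, hB⟩ := (isCompact_Icc (a := (0 : ℝ)) (b := T)).exists_bound_of_continuousOn
    (f := fun s => F s 0) (hF.comp (by fun_prop : Continuous fun s : ℝ => (s, (0 : E)))).continuousOn
  -- `n` is measurable only at each fixed time; exchanging the time integral with the expectation
  -- needs a jointly measurable version.
  obtain ⟨n', hn'm, hn'c, hn'⟩ := exists_continuous_modification hnm hnc
  have hn'2 : ∀ t ∈ Set.Icc 0 T, ∫⁻ ω, ‖n' t ω‖ₑ ^ 2 ∂P ≤ R := fun t ht => by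
    refine le_of_eq_of_le (lintegral_congr_ae ?_) (hn2 t ht)
    filter_upwards [hn'] with ω hω
    rw [hω]
  set e : ℝ≥0∞ := ENNReal.ofReal (Real.exp (C * T))
  set b : ℝ≥0∞ := ENNReal.ofReal (B * T)
  refine ⟨2 * (R + 2 * (b ^ 2 + (C : ℝ≥0∞) ^ 2 * (R * ENNReal.ofReal T ^ 2)) * e ^ 2), ?_,
    fun t ht => ?_⟩
  · have : b ≠ ∞ := ENNReal.ofReal_ne_top
    have : e ≠ ∞ := ENNReal.ofReal_ne_top
    have : R ≠ ∞ := hR.ne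
    rw [lt_top_iff_ne_top]
    finiteness
  have hB0 : 0 ≤ B := (norm_nonneg _).trans (hB 0 ⟨le_rfl, hT⟩)
  have hpt : ∀ᵐ ω ∂P, ‖Z t ω‖ₑ ^ 2 ≤ 2 * (‖n' t ω‖ₑ ^ 2 +
      2 * (b ^ 2 + (C : ℝ≥0∞) ^ 2 * (∫⁻ s in Set.Icc 0 T, ‖n' s ω‖ₑ) ^ 2) * e ^ 2) := by
    filter_upwards [hn', hZc, h] with ω h1 h2 h3
    have h4 := norm_le_of_integral_eq hL (hn'c ω) h2 hB (fun t ht => by rw [h1]; exact h3 t ht) t ht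
    have h5 : ENNReal.ofReal (∫ s in (0 : ℝ)..T, ‖n' s ω‖) = ∫⁻ s in Set.Icc 0 T, ‖n' s ω‖ₑ := by
      rw [intervalIntegral.integral_of_le hT, ← integral_Icc_eq_integral_Ioc,
        ofReal_integral_norm_eq_lintegral_enorm]
      exact (hn'c ω).continuousOn.integrableOn_compact isCompact_Icc
    have h6 : ‖Z t ω‖ₑ ≤ ‖n' t ω‖ₑ + (b + C * ∫⁻ s in Set.Icc 0 T, ‖n' s ω‖ₑ) * e := by
      have h7 : 0 ≤ ∫ s in (0 : ℝ)..T, ‖n' s ω‖ :=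
        intervalIntegral.integral_nonneg hT fun _ _ => norm_nonneg _
      rw [← h5, ← ofReal_norm, ← ofReal_norm, ← ENNReal.ofReal_coe_nnreal,
        ← ENNReal.ofReal_mul (NNReal.coe_nonneg C), ← ENNReal.ofReal_add (by positivity) (by positivity),
        ← ENNReal.ofReal_mul (by positivity), ← ENNReal.ofReal_add (by positivity) (by positivity)]
      exact ENNReal.ofReal_le_ofReal h4
    calc ‖Z t ω‖ₑ ^ 2
        ≤ (‖n' t ω‖ₑ + (b + C * ∫⁻ s in Set.Icc 0 T, ‖n' s ω‖ₑ) * e) ^ 2 := by gcongr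
      _ ≤ _ := ENNReal.add_sq_le_two_mul _ _
      _ ≤ _ := by
        rw [mul_pow, ← mul_pow (C : ℝ≥0∞)]
        gcongr
        exact ENNReal.add_sq_le_two_mul _ _
  have hDm : Measurable fun ω => ∫⁻ s in Set.Icc 0 T, ‖n' s ω‖ₑ :=
    Measurable.lintegral_prod_right' (f := fun p : Ω × ℝ => ‖n' p.2 p.1‖ₑ)
      (hn'm.comp measurable_swap).enorm
  have hnt : Measurable (n' t) := hn'm.of_uncurry_left
  refine (lintegral_mono_ae hpt).trans ?_
  rw [lintegral_const_mul _ (by fun_prop), lintegral_add_left (by fun_prop),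
    lintegral_mul_const _ (by fun_prop), lintegral_const_mul _ (by fun_prop),
    lintegral_add_left (by fun_prop), lintegral_const_mul _ (by fun_prop), lintegral_const,
    measure_univ, mul_one]
  gcongr
  · exact hn'2 t ht
  · exact lintegral_sq_lintegral_Icc_le hn'm.enorm
      fun s hs => hn'2 s hs

/-! ### The law of large numbers in mean square -/

/-- The mean square error of an empirical mean of independent vectors. -/
theorem lintegral_enorm_sq_integral_sub_mean_le {Ω V : Type*} [MeasurableSpace Ω] {P : Measure Ω}
    [IsProbabilityMeasure P] [NormedAddCommGroup V] [InnerProductSpace ℝ V]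
    [FiniteDimensional ℝ V] [MeasurableSpace V] [BorelSpace V]
    {M : ℕ} (hM : 0 < M) {ξ : Fin M → Ω → V} (hm : ∀ i, Measurable (ξ i)) (hi : iIndepFun ξ P)
    {ν : Measure V} (hν : ∀ i, P.map (ξ i) = ν) {S : ℝ≥0∞} (hS : S < ∞)
    (h2 : ∫⁻ v, ‖v‖ₑ ^ 2 ∂ν ≤ S) :
    ∫⁻ ω, ‖(∫ v, v ∂ν) - (M : ℝ)⁻¹ • ∑ i, ξ i ω‖ₑ ^ 2 ∂P ≤ S / M := by
  have hM0 : (M : ℝ) ≠ 0 := by exact_mod_cast hM.ne'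
  have hMpos : (0 : ℝ) < M := by exact_mod_cast hM
  have hL2 : ∀ i, ∫⁻ ω, ‖ξ i ω‖ₑ ^ 2 ∂P ≤ S := fun i => by
    rw [← hν i, lintegral_map (by fun_prop) (hm i)] at h2
    exact h2
  have hmem : ∀ i, MemLp (ξ i) 2 P := fun i =>
    ⟨(hm i).aestronglyMeasurable, by
      rw [eLpNorm_lt_top_iff_lintegral_rpow_enorm_lt_top (by norm_num) (by norm_num)]
      simpa using (hL2 i).trans_lt hS⟩
  have hmean : ∀ i, ∫ ω, ξ i ω ∂P = ∫ v, v ∂ν := fun i => by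
    rw [← hν i, integral_map (hm i).aemeasurable (by fun_prop)]
  -- Expanding the squared norm in an orthonormal basis reduces the claim to real variables, where
  -- independence makes variances add: `M⁻²` times a sum of `M` second moments.
  set b := stdOrthonormalBasis ℝ V
  have hXmem : ∀ k i, MemLp (fun ω => inner ℝ (b k) (ξ i ω)) 2 P := fun k i =>
    (hmem i).const_inner (b k)
  have hk : ∀ k, ∫⁻ ω, ‖inner ℝ (b k) ((∫ v, v ∂ν) - (M : ℝ)⁻¹ • ∑ i, ξ i ω)‖ₑ ^ 2 ∂P
      ≤ ((M : ℝ≥0∞)⁻¹) ^ 2 * ∑ i, ∫⁻ ω, ‖inner ℝ (b k) (ξ i ω)‖ₑ ^ 2 ∂P := by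
    intro k
    set Y : Fin M → Ω → ℝ := fun i ω => inner ℝ (b k) (ξ i ω) with hY
    have hYmean : ∀ i, ∫ ω, Y i ω ∂P = inner ℝ (b k) (∫ v, v ∂ν) := fun i => by
      rw [← hmean i, ← integral_inner ((hmem i).integrable (by norm_num))]
    have hYi : iIndepFun Y P := hi.comp (fun _ v => inner ℝ (b k) v) fun _ => by fun_prop
    have hYint : ∀ i, Integrable (Y i) P := fun i => (hXmem k i).integrable (by norm_num)
    have hAvg : MemLp (fun ω => (M : ℝ)⁻¹ * (∑ i, Y i) ω) 2 P :=
      (memLp_finsetSum' _ fun i _ => hXmem k i).const_mul _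
    have hAm : ∫ ω, (M : ℝ)⁻¹ * (∑ i, Y i) ω ∂P = inner ℝ (b k) (∫ v, v ∂ν) := by
      simp only [Finset.sum_apply]
      rw [integral_const_mul, integral_finsetSum _ fun i _ => hYint i]
      simp only [hYmean, Finset.sum_const, Finset.card_univ, Fintype.card_fin, nsmul_eq_mul]
      field_simp
    have hev : ∫⁻ ω, ‖inner ℝ (b k) ((∫ v, v ∂ν) - (M : ℝ)⁻¹ • ∑ i, ξ i ω)‖ₑ ^ 2 ∂P
        = evariance (fun ω => (M : ℝ)⁻¹ * (∑ i, Y i) ω) P := by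
      rw [evariance, hAm]
      refine lintegral_congr fun ω => ?_
      rw [inner_sub_right, inner_smul_right, inner_sum, ← enorm_neg]
      simp [hY]
    rw [hev, evariance_mul, ← ofReal_variance (memLp_finsetSum' _ fun i _ => hXmem k i),
      IndepFun.variance_sum (fun i _ => hXmem k i) fun i _ j _ hij => hYi.indepFun hij,
      ENNReal.ofReal_sum_of_nonneg fun _ _ => variance_nonneg _ _]
    have hc : ENNReal.ofReal ((M : ℝ)⁻¹ ^ 2) = ((M : ℝ≥0∞)⁻¹) ^ 2 := by
      rw [ENNReal.ofReal_pow (by positivity), ENNReal.ofReal_inv_of_pos hMpos,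
        ENNReal.ofReal_natCast]
    rw [hc]
    gcongr with i
    have := variance_le_expectation_sq (μ := P) (X := Y i) (hXmem k i).1
    refine (ENNReal.ofReal_le_ofReal this).trans (le_of_eq ?_)
    simp only [Pi.pow_apply, hY]
    rw [ofReal_integral_eq_lintegral_ofReal (hXmem k i).integrable_sq
      (ae_of_all _ fun _ => sq_nonneg _)]
    refine lintegral_congr fun ω => ?_
    rw [← ofReal_norm, ← ENNReal.ofReal_pow (norm_nonneg _)]
    simp
  have hsq : ∀ v : V, ‖v‖ₑ ^ 2 = ∑ k, ‖inner ℝ (b k) v‖ₑ ^ 2 := by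
    intro v
    simp only [← ofReal_norm, ← ENNReal.ofReal_pow (norm_nonneg _)]
    rw [← b.sum_sq_norm_inner_right v, ENNReal.ofReal_sum_of_nonneg fun _ _ => by positivity]
  have hsum : ∀ i, ∑ k, ∫⁻ ω, ‖inner ℝ (b k) (ξ i ω)‖ₑ ^ 2 ∂P = ∫⁻ ω, ‖ξ i ω‖ₑ ^ 2 ∂P := by
    intro i
    rw [← lintegral_finsetSum _ fun k _ => by have := hm i; fun_prop]
    exact lintegral_congr fun ω => (hsq _).symm
  calc ∫⁻ ω, ‖(∫ v, v ∂ν) - (M : ℝ)⁻¹ • ∑ i, ξ i ω‖ₑ ^ 2 ∂P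
      = ∑ k, ∫⁻ ω, ‖inner ℝ (b k) ((∫ v, v ∂ν) - (M : ℝ)⁻¹ • ∑ i, ξ i ω)‖ₑ ^ 2 ∂P := by
        rw [← lintegral_finsetSum _ fun k _ => by fun_prop]
        exact lintegral_congr fun ω => hsq _
    _ ≤ ∑ k, ((M : ℝ≥0∞)⁻¹) ^ 2 * ∑ i, ∫⁻ ω, ‖inner ℝ (b k) (ξ i ω)‖ₑ ^ 2 ∂P :=
        Finset.sum_le_sum fun k _ => hk k
    _ = ((M : ℝ≥0∞)⁻¹) ^ 2 * ∑ i, ∫⁻ ω, ‖ξ i ω‖ₑ ^ 2 ∂P := by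
        rw [← Finset.mul_sum, Finset.sum_comm]
        simp_rw [hsum]
    _ ≤ ((M : ℝ≥0∞)⁻¹) ^ 2 * ∑ _i : Fin M, S := by
        gcongr with i
        exact hL2 i
    _ = S / M := by
        have h0 : (M : ℝ≥0∞) ≠ 0 := by exact_mod_cast hM.ne'
        rw [Finset.sum_const, Finset.card_univ, Fintype.card_fin, nsmul_eq_mul, sq, mul_assoc,
          ← mul_assoc _ (M : ℝ≥0∞), ENNReal.inv_mul_cancel h0 (ENNReal.natCast_ne_top M), one_mul,
          ENNReal.div_eq_inv_mul]

/-! ### Synchronous coupling -/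

theorem LipschitzWith.norm_sub_le_add {V E F : Type*} [NormedAddCommGroup V]
    [NormedAddCommGroup E] [NormedAddCommGroup F] {f : V × E → F} {C : ℝ≥0}
    (hf : LipschitzWith C f) (v v' : V) (z z' : E) :
    ‖f (v, z) - f (v', z')‖ ≤ C * (‖v - v'‖ + ‖z - z'‖) := by
  have h := hf.dist_le_mul (v, z) (v', z')
  rw [dist_eq_norm, Prod.dist_eq, dist_eq_norm, dist_eq_norm] at h
  refine h.trans (mul_le_mul_of_nonneg_left ?_ C.2)
  exact max_le (le_add_of_nonneg_right (norm_nonneg _)) (le_add_of_nonneg_left (norm_nonneg _))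

/-- Pathwise comparison of the mean-field equation, synchronously coupled copies of its solution,
and the interacting particle system. -/
theorem coupling_pathwise_bound {E V : Type*} [NormedAddCommGroup E] [NormedSpace ℝ E]
    [NormedAddCommGroup V] [NormedSpace ℝ V] {T : ℝ}
    {G : V × E → E} {H : V × E → V} {C : ℝ≥0} (hG : LipschitzWith C G) (hH : LipschitzWith C H)
    {Θ Θ' hbar : ℝ → V} (hΘc : Continuous Θ) (hΘ'c : Continuous Θ')
    (hbi : IntervalIntegrable hbar volume 0 T) {Θ₀ : V}
    (hΘ : ∀ t ∈ Set.Icc 0 T, Θ t = Θ₀ + ∫ s in (0 : ℝ)..t, hbar s)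
    {M : ℕ} (hM : 0 < M) {Y Z n : Fin M → ℝ → E}
    (hYc : ∀ i, Continuous (Y i)) (hZc : ∀ i, Continuous (Z i))
    (hΘ' : ∀ t ∈ Set.Icc 0 T,
      Θ' t = Θ₀ + ∫ s in (0 : ℝ)..t, (M : ℝ)⁻¹ • ∑ i, H (Θ' s, Z i s))
    (hY : ∀ i, ∀ t ∈ Set.Icc 0 T, Y i t = n i t + ∫ s in (0 : ℝ)..t, G (Θ s, Y i s))
    (hZ : ∀ i, ∀ t ∈ Set.Icc 0 T, Z i t = n i t + ∫ s in (0 : ℝ)..t, G (Θ' s, Z i s)) :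
    ∀ t ∈ Set.Icc 0 T,
      ‖Θ t - Θ' t‖ ≤ (1 + C * T) * Real.exp (3 * C * T) *
        ∫ s in (0 : ℝ)..T, ‖hbar s - (M : ℝ)⁻¹ • ∑ i, H (Θ s, Y i s)‖ ∧
      ∀ i, ‖Y i t - Z i t‖ ≤ (1 + C * T) * Real.exp (3 * C * T) *
        ∫ s in (0 : ℝ)..T, ‖hbar s - (M : ℝ)⁻¹ • ∑ i, H (Θ s, Y i s)‖ := by
  intro t₀ ht₀
  have hT : 0 ≤ T := ht₀.1.trans ht₀.2
  have hMpos : (0 : ℝ) < M := by exact_mod_cast hM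
  have hGc := hG.continuous
  have hHc := hH.continuous
  have hAY : Continuous fun s => (M : ℝ)⁻¹ • ∑ i, H (Θ s, Y i s) := by fun_prop
  have hAZ : Continuous fun s => (M : ℝ)⁻¹ • ∑ i, H (Θ' s, Z i s) := by fun_prop
  have hδ : IntervalIntegrable (fun s => hbar s - (M : ℝ)⁻¹ • ∑ i, H (Θ s, Y i s)) volume 0 T :=
    hbi.sub (hAY.intervalIntegrable _ _)
  refine mean_field_gronwall hM (a := fun t => ‖Θ t - Θ' t‖) (b := fun i t => ‖Y i t - Z i t‖)
    (by fun_prop) (fun i => by fun_prop) (fun _ => norm_nonneg _) (fun _ _ => norm_nonneg _)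
    C.2 (intervalIntegral.integral_nonneg hT fun _ _ => norm_nonneg _) ?_ ?_ t₀ ht₀
  · intro t ht
    have hsub : Set.uIcc 0 t ⊆ Set.uIcc 0 T := by
      rw [Set.uIcc_of_le ht.1, Set.uIcc_of_le hT]; exact Set.Icc_subset_Icc_right ht.2
    have hδt := hδ.mono_set hsub
    -- The empirical drift along the copies is inserted between the two drifts. The first integral
    -- is the fluctuation of independent variables; the second is Lipschitz in the differences.
    have heq : Θ t - Θ' t = (∫ s in (0 : ℝ)..t, (hbar s - (M : ℝ)⁻¹ • ∑ i, H (Θ s, Y i s)))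
        + ∫ s in (0 : ℝ)..t, ((M : ℝ)⁻¹ • ∑ i, H (Θ s, Y i s)
          - (M : ℝ)⁻¹ • ∑ i, H (Θ' s, Z i s)) := by
      rw [hΘ t ht, hΘ' t ht, intervalIntegral.integral_sub (hbi.mono_set hsub)
        (hAY.intervalIntegrable _ _), intervalIntegral.integral_sub (hAY.intervalIntegrable _ _)
        (hAZ.intervalIntegrable _ _)]
      abel
    change ‖Θ t - Θ' t‖ ≤ _
    rw [heq]
    refine (norm_add_le _ _).trans (add_le_add ?_ ?_)
    · refine (intervalIntegral.norm_integral_le_integral_norm ht.1).trans ?_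
      exact intervalIntegral.integral_mono_interval le_rfl ht.1 ht.2
        (ae_of_all _ fun _ => norm_nonneg _) hδ.norm
    · rw [← intervalIntegral.integral_const_mul]
      refine intervalIntegral.norm_integral_le_of_norm_le ht.1 (ae_of_all _ fun s _ => ?_)
        (Continuous.intervalIntegrable (by fun_prop) _ _)
      rw [← smul_sub, ← Finset.sum_sub_distrib, norm_smul, Real.norm_of_nonneg (by positivity)]
      have h1 : ‖∑ i, (H (Θ s, Y i s) - H (Θ' s, Z i s))‖
          ≤ ∑ i, C * (‖Θ s - Θ' s‖ + ‖Y i s - Z i s‖) :=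
        norm_sum_le_of_le _ fun i _ => hH.norm_sub_le_add _ _ _ _
      refine (mul_le_mul_of_nonneg_left h1 (by positivity)).trans (le_of_eq ?_)
      rw [← Finset.mul_sum, Finset.sum_add_distrib, Finset.sum_const, Finset.card_univ,
        Fintype.card_fin, nsmul_eq_mul]
      simp only [NNReal.val_eq_coe]
      field_simp
  · intro i t ht
    -- Copy and particle share the forcing `n i`, so initial point and noise cancel.
    have heq : Y i t - Z i t = ∫ s in (0 : ℝ)..t, (G (Θ s, Y i s) - G (Θ' s, Z i s)) := by
      rw [hY i t ht, hZ i t ht, intervalIntegral.integral_sub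
        (Continuous.intervalIntegrable (by fun_prop) _ _)
        (Continuous.intervalIntegrable (by fun_prop) _ _)]
      abel
    change ‖Y i t - Z i t‖ ≤ _
    rw [heq, ← intervalIntegral.integral_const_mul]
    exact intervalIntegral.norm_integral_le_of_norm_le ht.1
      (ae_of_all _ fun s _ => hG.norm_sub_le_add _ _ _ _)
      (Continuous.intervalIntegrable (by fun_prop) _ _)

/-- Quantitative propagation of chaos for synchronously coupled particles: all differences are
controlled by one random variable `D` with second moment `O(1 / M)`. -/
theorem exists_coupling_error {Ω E V : Type*} [MeasurableSpace Ω] {P : Measure Ω}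
    [IsProbabilityMeasure P] [NormedAddCommGroup E] [NormedSpace ℝ E] [MeasurableSpace E]
    [BorelSpace E] [SecondCountableTopology E] [NormedAddCommGroup V] [InnerProductSpace ℝ V]
    [FiniteDimensional ℝ V] [MeasurableSpace V] [BorelSpace V] {T : ℝ} (hT : 0 ≤ T)
    {G : V × E → E} {H : V × E → V} {C : ℝ≥0} (hG : LipschitzWith C G) (hH : LipschitzWith C H)
    {Θ hbar : ℝ → V} (hΘc : Continuous Θ) (hbm : Measurable hbar)
    (hbi : IntervalIntegrable hbar volume 0 T) {Θ₀ : V}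
    (hΘ : ∀ t ∈ Set.Icc 0 T, Θ t = Θ₀ + ∫ s in (0 : ℝ)..t, hbar s)
    {ν : ℝ → Measure E} (hbar_eq : ∀ s ∈ Set.Icc 0 T, hbar s = ∫ z, H (Θ s, z) ∂ν s)
    {S : ℝ≥0∞} (hS : S < ∞) (hS2 : ∀ s ∈ Set.Icc 0 T, ∫⁻ z, ‖H (Θ s, z)‖ₑ ^ 2 ∂ν s ≤ S)
    {M : ℕ} (hM : 0 < M) {Θ' : ℝ → Ω → V} (hΘ'c : ∀ᵐ ω ∂P, Continuous fun t => Θ' t ω)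
    {Y Z n : Fin M → ℝ → Ω → E} (hYm : ∀ i, Measurable (Function.uncurry (Y i)))
    (hYc : ∀ i ω, Continuous fun t => Y i t ω) (hZc : ∀ i, ∀ᵐ ω ∂P, Continuous fun t => Z i t ω)
    (hν : ∀ s ∈ Set.Icc 0 T, ∀ i, P.map (Y i s) = ν s)
    (hind : ∀ s ∈ Set.Icc 0 T, iIndepFun (fun i => Y i s) P)
    (hΘ' : ∀ᵐ ω ∂P, ∀ t ∈ Set.Icc 0 T,
      Θ' t ω = Θ₀ + ∫ s in (0 : ℝ)..t, (M : ℝ)⁻¹ • ∑ i, H (Θ' s ω, Z i s ω))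
    (hY : ∀ i, ∀ᵐ ω ∂P, ∀ t ∈ Set.Icc 0 T,
      Y i t ω = n i t ω + ∫ s in (0 : ℝ)..t, G (Θ s, Y i s ω))
    (hZ : ∀ i, ∀ᵐ ω ∂P, ∀ t ∈ Set.Icc 0 T,
      Z i t ω = n i t ω + ∫ s in (0 : ℝ)..t, G (Θ' s ω, Z i s ω)) :
    ∃ D : Ω → ℝ≥0∞, Measurable D ∧ ∫⁻ ω, D ω ^ 2 ∂P ≤ S / M * ENNReal.ofReal T ^ 2 ∧
      ∀ᵐ ω ∂P, ∀ t ∈ Set.Icc 0 T,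
        ‖Θ t - Θ' t ω‖ₑ ≤ ENNReal.ofReal ((1 + C * T) * Real.exp (3 * C * T)) * D ω ∧
        ∀ i, ‖Y i t ω - Z i t ω‖ₑ ≤
          ENNReal.ofReal ((1 + C * T) * Real.exp (3 * C * T)) * D ω := by
  have hHc := hH.continuous
  have hHm : Measurable H := hHc.measurable
  have hδm : Measurable (Function.uncurry fun (s : ℝ) ω =>
      ‖hbar s - (M : ℝ)⁻¹ • ∑ i, H (Θ s, Y i s ω)‖ₑ) := by
    refine Measurable.enorm ((hbm.comp measurable_fst).sub (Measurable.const_smul ?_ _))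
    refine Finset.measurable_fun_sum _ fun i _ => hHm.comp ?_
    exact (hΘc.measurable.comp measurable_fst).prodMk (hYm i)
  -- This `D` involves the copies but not the interacting particles, so independence of the `Y i s`
  -- at each fixed time is enough to estimate it.
  refine ⟨fun ω => ∫⁻ s in Set.Icc 0 T, ‖hbar s - (M : ℝ)⁻¹ • ∑ i, H (Θ s, Y i s ω)‖ₑ,
    ?_, ?_, ?_⟩
  · exact Measurable.lintegral_prod_right' (hδm.comp measurable_swap)
  · refine lintegral_sq_lintegral_Icc_le hδm fun s hs => ?_
    have hHs : Measurable fun z => H (Θ s, z) := by fun_prop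
    have hYs : ∀ i, Measurable (Y i s) := fun i => (hYm i).of_uncurry_left
    have key := lintegral_enorm_sq_integral_sub_mean_le (P := P) hM
      (ξ := fun i ω => H (Θ s, Y i s ω)) (fun i => hHs.comp (hYs i))
      ((hind s hs).comp (fun _ z => H (Θ s, z)) fun _ => hHs)
      (ν := (ν s).map fun z => H (Θ s, z))
      (fun i => by rw [← hν s hs i, Measure.map_map hHs (hYs i)]; rfl) hS
      (by rw [lintegral_map (by fun_prop) hHs]; exact hS2 s hs)
    rw [integral_map hHs.aemeasurable (by fun_prop), ← hbar_eq s hs] at key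
    exact key
  · filter_upwards [hΘ'c, ae_all_iff.2 hZc, hΘ', ae_all_iff.2 hY, ae_all_iff.2 hZ]
      with ω h1 h2 h3 h4 h5 t ht
    have hb := coupling_pathwise_bound hG hH hΘc h1 hbi hΘ hM (Y := fun i t => Y i t ω)
      (Z := fun i t => Z i t ω) (n := fun i t => n i t ω) (fun i => hYc i ω) h2 h3 h4 h5 t ht
    have hint : IntervalIntegrable (fun s => hbar s - (M : ℝ)⁻¹ • ∑ i, H (Θ s, Y i s ω))
        volume 0 T := by
      have := fun i => hYc i ω
      exact hbi.sub (Continuous.intervalIntegrable (by fun_prop) _ _)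
    have hD : ENNReal.ofReal (∫ s in (0 : ℝ)..T, ‖hbar s - (M : ℝ)⁻¹ • ∑ i, H (Θ s, Y i s ω)‖)
        = ∫⁻ s in Set.Icc 0 T, ‖hbar s - (M : ℝ)⁻¹ • ∑ i, H (Θ s, Y i s ω)‖ₑ := by
      rw [intervalIntegral.integral_of_le hT, restrict_Ioc_eq_restrict_Icc,
        ofReal_integral_norm_eq_lintegral_enorm]
      rw [← restrict_Ioc_eq_restrict_Icc]
      exact (intervalIntegrable_iff_integrableOn_Ioc_of_le hT).1 hint
    rw [← hD, ← ENNReal.ofReal_mul (by positivity)]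
    refine ⟨?_, fun i => ?_⟩
    · rw [← ofReal_norm]; exact ENNReal.ofReal_le_ofReal hb.1
    · rw [← ofReal_norm]; exact ENNReal.ofReal_le_ofReal (hb.2 i)

/-! ### Euclidean pairs -/

theorem norm_epair_le {a b : ℕ} (x : EVec a) (y : EVec b) : ‖epair x y‖ ≤ ‖x‖ + ‖y‖ := by
  have h := WithLp.prod_norm_sq_eq_of_L2 (epair x y)
  refine abs_le_of_sq_le_sq' ?_ (by positivity) |>.2
  rw [h]
  simp only [WithLp.toLp_fst, WithLp.toLp_snd]
  nlinarith [norm_nonneg x, norm_nonneg y]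

theorem LipschitzWith.epair {α : Type*} [PseudoEMetricSpace α] {a b : ℕ} {f : α → EVec a}
    {g : α → EVec b} {K L : ℝ≥0} (hf : LipschitzWith K f) (hg : LipschitzWith L g) :
    LipschitzWith (K + L) fun x => epair (f x) (g x) := by
  intro x y
  have h : edist (_root_.epair (f x) (g x)) (_root_.epair (f y) (g y))
      ≤ edist (f x) (f y) + edist (g x) (g y) := by
    rw [edist_dist, edist_dist, edist_dist, ← ENNReal.ofReal_add dist_nonneg dist_nonneg,
      dist_eq_norm, dist_eq_norm, dist_eq_norm]
    exact ENNReal.ofReal_le_ofReal (norm_epair_le (f x - f y) (g x - g y))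
  refine h.trans ((add_le_add (hf x y) (hg x y)).trans (le_of_eq ?_))
  push_cast; ring

theorem lipschitzWith_epair_fst {a b : ℕ} : LipschitzWith 1 (fun p : EPair a b => p.fst) :=
  LipschitzWith.of_dist_le_mul fun x y => by
    rw [dist_eq_norm, dist_eq_norm, NNReal.coe_one, one_mul]
    exact WithLp.norm_fst_le _ (x - y)

theorem lipschitzWith_epair_snd {a b : ℕ} : LipschitzWith 1 (fun p : EPair a b => p.snd) :=
  LipschitzWith.of_dist_le_mul fun x y => by
    rw [dist_eq_norm, dist_eq_norm, NNReal.coe_one, one_mul]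
    exact WithLp.norm_snd_le _ (x - y)

@[fun_prop]
theorem Continuous.epair {α : Type*} [TopologicalSpace α] {a b : ℕ} {f : α → EVec a}
    {g : α → EVec b} (hf : Continuous f) (hg : Continuous g) :
    Continuous fun x => epair (f x) (g x) :=
  (WithLp.prod_continuous_toLp 2 _ _).comp (hf.prodMk hg)

@[fun_prop]
theorem Measurable.epair {α : Type*} [MeasurableSpace α] {a b : ℕ} {f : α → EVec a}
    {g : α → EVec b} (hf : Measurable f) (hg : Measurable g) :
    Measurable fun x => epair (f x) (g x) :=
  (WithLp.measurable_toLp 2 _).comp (hf.prodMk hg)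

theorem intervalIntegral_fst {a b : ℕ} {f : ℝ → EPair a b} {s t : ℝ}
    (hf : IntervalIntegrable f volume s t) : (∫ r in s..t, f r).fst = ∫ r in s..t, (f r).fst :=
  ((WithLp.fstL 2 ℝ (EVec a) (EVec b)).intervalIntegral_comp_comm hf).symm

theorem intervalIntegral_snd {a b : ℕ} {f : ℝ → EPair a b} {s t : ℝ}
    (hf : IntervalIntegrable f volume s t) : (∫ r in s..t, f r).snd = ∫ r in s..t, (f r).snd :=
  ((WithLp.sndL 2 ℝ (EVec a) (EVec b)).intervalIntegral_comp_comm hf).symm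

theorem epair_ext {a b : ℕ} {p q : EPair a b} (h1 : p.fst = q.fst) (h2 : p.snd = q.snd) : p = q :=
  WithLp.ofLp_injective 2 (Prod.ext h1 h2)

/-! ### Lipschitz drifts -/

section Drifts

variable {dθ dx : ℕ} {ell : EPair dθ dx → ℝ}

/-- Chain rule along the inclusion `θ' ↦ (θ', x)`. It passes the Lipschitz bound, which is assumed
for the full gradient, on to the partial one. -/
theorem gradTheta_eq_fst (hd : Differentiable ℝ ell) (θ : EVec dθ) (x : EVec dx) :
    gradTheta ell θ x = (gradient ell (epair θ x)).fst := by
  refine HasGradientAt.gradient ?_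
  rw [hasGradientAt_iff_hasFDerivAt]
  have h1 := (hd (epair θ x)).hasGradientAt.hasFDerivAt
  have h2 : HasFDerivAt (fun θ' : EVec dθ => epair θ' x)
      (((WithLp.prodContinuousLinearEquiv 2 ℝ (EVec dθ) (EVec dx)).symm :
        EVec dθ × EVec dx →L[ℝ] EPair dθ dx).comp (ContinuousLinearMap.inl ℝ _ _)) θ :=
    ((WithLp.prodContinuousLinearEquiv 2 ℝ (EVec dθ) (EVec dx)).symm.hasFDerivAt).comp θ
      (hasFDerivAt_prodMk_left θ x)
  refine (h1.comp θ h2).congr_fderiv ?_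
  generalize gradient ell (epair θ x) = g
  ext v
  simp [WithLp.prod_inner_apply]

theorem gradX_eq_snd (hd : Differentiable ℝ ell) (θ : EVec dθ) (x : EVec dx) :
    gradX ell θ x = (gradient ell (epair θ x)).snd := by
  refine HasGradientAt.gradient ?_
  rw [hasGradientAt_iff_hasFDerivAt]
  have h1 := (hd (epair θ x)).hasGradientAt.hasFDerivAt
  have h2 : HasFDerivAt (fun x' : EVec dx => epair θ x')
      (((WithLp.prodContinuousLinearEquiv 2 ℝ (EVec dθ) (EVec dx)).symm :
        EVec dθ × EVec dx →L[ℝ] EPair dθ dx).comp (ContinuousLinearMap.inr ℝ _ _)) x :=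
    ((WithLp.prodContinuousLinearEquiv 2 ℝ (EVec dθ) (EVec dx)).symm.hasFDerivAt).comp x
      (hasFDerivAt_prodMk_right θ x)
  refine (h1.comp x h2).congr_fderiv ?_
  generalize gradient ell (epair θ x) = g
  ext v
  simp [WithLp.prod_inner_apply]

/-- The drift of `(X, U)`, as a function of `((θ, m), (X, U))`. -/
noncomputable def stateDrift (ell : EPair dθ dx → ℝ) (ηx γx : ℝ)
    (p : EPair dθ dθ × EPair dx dx) : EPair dx dx :=
  epair (ηx • p.2.snd) (gradX ell p.1.fst p.2.fst - (γx * ηx) • p.2.snd)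

/-- The drift of `(θ, m)` before averaging, as a function of `((θ, m), (X, U))`. -/
noncomputable def paramDrift (ell : EPair dθ dx → ℝ) (ηθ γθ : ℝ)
    (p : EPair dθ dθ × EPair dx dx) : EPair dθ dθ :=
  epair (ηθ • p.1.snd) (gradTheta ell p.1.fst p.2.fst - (γθ * ηθ) • p.1.snd)

theorem HasLipschitzGradient.exists_lipschitzWith_drifts (hell : HasLipschitzGradient ell)
    (ηθ γθ ηx γx : ℝ) : ∃ C : ℝ≥0, LipschitzWith C (stateDrift ell ηx γx) ∧
      LipschitzWith C (paramDrift ell ηθ γθ) := by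
  obtain ⟨hd, K, hK, hL⟩ := hell
  have hgrad : LipschitzWith K.toNNReal (gradient ell) := LipschitzWith.of_dist_le_mul fun z z' => by
    rw [dist_eq_norm, dist_eq_norm, Real.coe_toNNReal _ hK.le]; exact hL z z'
  have hpt := (lipschitzWith_epair_fst.comp (LipschitzWith.prod_fst
      (α := EPair dθ dθ) (β := EPair dx dx))).epair
    (lipschitzWith_epair_fst.comp (LipschitzWith.prod_snd (α := EPair dθ dθ) (β := EPair dx dx)))
  have hv := lipschitzWith_epair_snd.comp
    (LipschitzWith.prod_fst (α := EPair dθ dθ) (β := EPair dx dx))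
  have hu := lipschitzWith_epair_snd.comp
    (LipschitzWith.prod_snd (α := EPair dθ dθ) (β := EPair dx dx))
  have hT := lipschitzWith_epair_fst.comp (hgrad.comp hpt)
  have hX := lipschitzWith_epair_snd.comp (hgrad.comp hpt)
  have hG := ((lipschitzWith_smul ηx).comp hu).epair (hX.sub ((lipschitzWith_smul (γx * ηx)).comp hu))
  have hH := ((lipschitzWith_smul ηθ).comp hv).epair (hT.sub ((lipschitzWith_smul (γθ * ηθ)).comp hv))
  have hG' : stateDrift ell ηx γx = fun p => epair (ηx • p.2.snd)
      ((gradient ell (epair p.1.fst p.2.fst)).snd - (γx * ηx) • p.2.snd) := funext fun p => by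
    rw [stateDrift, gradX_eq_snd hd]
  have hH' : paramDrift ell ηθ γθ = fun p => epair (ηθ • p.1.snd)
      ((gradient ell (epair p.1.fst p.2.fst)).fst - (γθ * ηθ) • p.1.snd) := funext fun p => by
    rw [paramDrift, gradTheta_eq_fst hd]
  rw [hG', hH']
  exact ⟨max _ _, hG.weaken (le_max_left _ _), hH.weaken (le_max_right _ _)⟩

end Drifts

/-! ### Solution processes driven by random paths -/

theorem LipschitzWith.section_right {V E F : Type*} [NormedAddCommGroup V]
    [NormedAddCommGroup E] [NormedAddCommGroup F] {f : V × E → F} {C : ℝ≥0}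
    (hf : LipschitzWith C f) (v : V) : LipschitzWith C fun z => f (v, z) :=
  LipschitzWith.of_dist_le_mul fun z z' => by
    simpa [dist_eq_norm] using hf.norm_sub_le_add v v z z'

theorem IsWienerProcess.ae_continuous {Ω : Type*} [MeasurableSpace Ω] {d : ℕ}
    {W : ℝ≥0 → Ω → EVec d} {P : Measure Ω} (h : IsWienerProcess W P) :
    ∀ᵐ ω ∂P, Continuous fun t => W t ω := by
  filter_upwards [ae_all_iff.2 fun j => (h.isBrownian j).cont] with ω hω
  exact (PiLp.continuous_toLp 2 _).comp (continuous_pi hω)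

/-- The flow map evaluated along an almost surely continuous driving process has a jointly
measurable, continuous version, which solves the equation. -/
theorem exists_pathSolution_process {Ω E E' : Type*} [MeasurableSpace Ω] {P : Measure Ω}
    [NormedAddCommGroup E] [NormedSpace ℝ E] [CompleteSpace E] [SecondCountableTopology E]
    [MeasurableSpace E] [BorelSpace E] [TopologicalSpace E'] [MeasurableSpace E']
    {F : ℝ → E → E} (hF : Continuous (Function.uncurry F)) {C : ℝ≥0}
    (hL : ∀ s, LipschitzWith C (F s)) {J : E' → E} (hJ : Continuous J) (hJm : Measurable J)
    {x : Ω → E} (hx : Measurable x) {W : ℝ≥0 → Ω → E'} (hW : ∀ t, Measurable (W t))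
    (hWc : ∀ᵐ ω ∂P, Continuous fun t => W t ω) {T : ℝ} (hT : 0 ≤ T) :
    ∃ Y : ℝ → Ω → E, Measurable (Function.uncurry Y) ∧ (∀ ω, Continuous fun t => Y t ω) ∧
      (∀ s ∈ Set.Icc 0 T, ∀ᵐ ω ∂P, Y s ω = pathSolution F J s (x ω, fun t => W t ω)) ∧
      ∀ᵐ ω ∂P, ∀ t ∈ Set.Icc 0 T,
        Y t ω = x ω + J (W t.toNNReal ω) + ∫ s in (0 : ℝ)..t, F s (Y s ω) := by
  -- Time is clamped to `[0, T]`, where a solution is available, so that the paths are continuous on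
  -- all of `ℝ`.
  set Y₀ : ℝ → Ω → E := fun s ω =>
    pathSolution F J (Set.projIcc 0 T hT s) (x ω, fun t => W t ω) with hY₀
  -- Picard iteration supplies a solution along each continuous noise path, and the Euler limit must
  -- equal it: the limit gives measurability in `ω`, the solution gives continuity in time.
  have hsol : ∀ᵐ ω ∂P, ∃ z : ℝ → E, Continuous z ∧
      (∀ t ∈ Set.Icc 0 T, z t = x ω + J (W t.toNNReal ω) + ∫ s in (0 : ℝ)..t, F s (z s)) ∧
      ∀ s, Y₀ s ω = z (Set.projIcc 0 T hT s) := by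
    filter_upwards [hWc] with ω hω
    obtain ⟨z, hz, hzeq⟩ := exists_integral_eq_of_lipschitz hF hL
      (n := fun t => x ω + J (W t.toNNReal ω)) (by fun_prop) hT
    refine ⟨z, hz, hzeq, fun s => ?_⟩
    have hs := (Set.projIcc 0 T hT s).2
    exact pathSolution_eq hF hL hz hs.1 fun r hr => hzeq r ⟨hr.1, hr.2.trans hs.2⟩
  have hm : ∀ s, Measurable (Y₀ s) := fun s =>
    (measurable_pathSolution (fun r => (hL r).continuous.measurable) hJm _).comp
      (hx.prodMk (measurable_pi_lambda _ hW))
  have hc : ∀ᵐ ω ∂P, Continuous fun s => Y₀ s ω := by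
    filter_upwards [hsol] with ω ⟨z, hz, _, hYz⟩
    simp_rw [hYz]
    fun_prop
  obtain ⟨Y, hYm, hYc, hY⟩ := exists_continuous_modification hm hc
  refine ⟨Y, hYm, hYc, fun s hs => ?_, ?_⟩
  · filter_upwards [hY] with ω hω
    rw [hω, hY₀]
    simp only [Set.projIcc_of_mem hT hs]
  · filter_upwards [hY, hsol] with ω hω ⟨z, hz, hzeq, hYz⟩ t ht
    have hYz' : ∀ s ∈ Set.Icc 0 T, Y s ω = z s := fun s hs => by
      rw [hω, hYz, Set.projIcc_of_mem hT hs]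
    rw [hYz' t ht, hzeq t ht]
    congr 1
    refine intervalIntegral.integral_congr fun s hs => ?_
    rw [Set.uIcc_of_le ht.1] at hs
    simp only [hYz' s ⟨hs.1, hs.2.trans ht.2⟩]

/-! ### The mean-field flow in phase space -/

section Flow

variable {dθ dx : ℕ} {ell : EPair dθ dx → ℝ}

/-- The noise enters the velocity component. -/
noncomputable def noiseEmbed (γx : ℝ) (w : EVec dx) : EPair dx dx := epair 0 (√(2 * γx) • w)

theorem continuous_noiseEmbed (γx : ℝ) : Continuous (noiseEmbed (dx := dx) γx) := by
  unfold noiseEmbed; fun_prop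

theorem measurable_noiseEmbed (γx : ℝ) : Measurable (noiseEmbed (dx := dx) γx) :=
  (continuous_noiseEmbed γx).measurable

theorem norm_noiseEmbed (γx : ℝ) (w : EVec dx) : ‖noiseEmbed γx w‖ = √(2 * γx) * ‖w‖ := by
  have h := WithLp.prod_norm_sq_eq_of_L2 (noiseEmbed γx w)
  simp only [noiseEmbed, WithLp.toLp_fst, WithLp.toLp_snd, norm_zero, norm_smul,
    Real.norm_of_nonneg (Real.sqrt_nonneg _)] at h ⊢
  exact (sq_eq_sq₀ (norm_nonneg _) (by positivity)).1 (by rw [h]; ring)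

/-- The position and velocity equations as one equation in phase space. -/
theorem epair_state_eq {ηx γx : ℝ} (hG : Continuous (stateDrift ell ηx γx))
    {θ m : ℝ≥0 → EVec dθ} {X U w : ℝ≥0 → EVec dx} (hθ : Continuous θ) (hm : Continuous m)
    (hXc : Continuous X) (hUc : Continuous U)
    (hX : ∀ t : ℝ≥0, X t = X 0 + ∫ s in (0 : ℝ)..t, ηx • U s.toNNReal)
    (hU : ∀ t : ℝ≥0, U t = U 0 + (∫ s in (0 : ℝ)..t,
      (gradX ell (θ s.toNNReal) (X s.toNNReal) - (γx * ηx) • U s.toNNReal)) + √(2 * γx) • w t)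
    {t : ℝ} (ht : 0 ≤ t) :
    epair (X t.toNNReal) (U t.toNNReal) = epair (X 0) (U 0) + noiseEmbed γx (w t.toNNReal)
      + ∫ s in (0 : ℝ)..t, stateDrift ell ηx γx
          (epair (θ s.toNNReal) (m s.toNNReal), epair (X s.toNNReal) (U s.toNNReal)) := by
  have hint : IntervalIntegrable (fun s : ℝ => stateDrift ell ηx γx
      (epair (θ s.toNNReal) (m s.toNNReal), epair (X s.toNNReal) (U s.toNNReal))) volume 0 t :=
    Continuous.intervalIntegrable (by fun_prop) _ _
  have h1 := hX t.toNNReal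
  have h2 := hU t.toNNReal
  rw [Real.coe_toNNReal t ht] at h1 h2
  refine epair_ext ?_ ?_
  · rw [WithLp.add_fst, WithLp.add_fst, intervalIntegral_fst hint]
    simp only [stateDrift, noiseEmbed, WithLp.toLp_fst, WithLp.toLp_snd, add_zero]
    exact h1
  · rw [WithLp.add_snd, WithLp.add_snd, intervalIntegral_snd hint]
    simp only [stateDrift, noiseEmbed, WithLp.toLp_fst, WithLp.toLp_snd]
    rw [h2]; abel

variable {Ω : Type*} [MeasurableSpace Ω] {P : Measure Ω}
  {ηθ γθ ηx γx : ℝ} {θ₀ m₀ : EVec dθ} {q₀ : Measure (EPair dx dx)}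
  {W : ℝ≥0 → Ω → EVec dx} {θ m : ℝ≥0 → EVec dθ} {X U : ℝ≥0 → Ω → EVec dx}

theorem IsMeanFieldFlow.ae_state_eq (h : IsMeanFieldFlow P ell ηθ γθ ηx γx θ₀ m₀ q₀ W θ m X U)
    (hG : Continuous (stateDrift ell ηx γx)) :
    ∀ᵐ ω ∂P, Continuous (fun t : ℝ => epair (X t.toNNReal ω) (U t.toNNReal ω)) ∧
      ∀ t : ℝ, 0 ≤ t → epair (X t.toNNReal ω) (U t.toNNReal ω)
        = epair (X 0 ω) (U 0 ω) + noiseEmbed γx (W t.toNNReal ω)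
          + ∫ s in (0 : ℝ)..t, stateDrift ell ηx γx (epair (θ s.toNNReal) (m s.toNNReal),
              epair (X s.toNNReal ω) (U s.toNNReal ω)) := by
  filter_upwards [h.continuous_X, h.continuous_U, h.eq_X, h.eq_U] with ω h1 h2 h3 h4
  exact ⟨by fun_prop, fun t ht =>
    epair_state_eq hG h.continuous_θ h.continuous_m h1 h2 h3 h4 (w := fun t => W t ω) ht⟩

/-- Moments at positive times are derived, not assumed: with `(θ, m)` deterministic and continuous,
the law no longer enters the state equation, and the a priori bound for Lipschitz Volterra equations
applies. -/
theorem IsMeanFieldFlow.exists_moment_bound [IsProbabilityMeasure P]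
    (h : IsMeanFieldFlow P ell ηθ γθ ηx γx θ₀ m₀ q₀ W θ m X U)
    (hq₀ : ∫⁻ z, ‖z‖ₑ ^ 2 ∂q₀ < ∞)
    {C : ℝ≥0} (hG : LipschitzWith C (stateDrift ell ηx γx)) {T : ℝ} (hT : 0 ≤ T) :
    ∃ S : ℝ≥0∞, S < ∞ ∧ ∀ t ∈ Set.Icc 0 T,
      ∫⁻ ω, ‖epair (X t.toNNReal ω) (U t.toNNReal ω)‖ₑ ^ 2 ∂P ≤ S := by
  have hXm := h.measurable_X
  have hUm := h.measurable_U
  have hWm := h.wiener.measurable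
  have hGc := hG.continuous
  have hθ := h.continuous_θ
  have hm := h.continuous_m
  have hJ := measurable_noiseEmbed (dx := dx) γx
  have hJc := continuous_noiseEmbed (dx := dx) γx
  refine exists_lintegral_enorm_sq_le
    (F := fun s z => stateDrift ell ηx γx (epair (θ s.toNNReal) (m s.toNNReal), z))
    (n := fun t ω => epair (X 0 ω) (U 0 ω) + noiseEmbed γx (W t.toNNReal ω))
    (R := 2 * (∫⁻ z, ‖z‖ₑ ^ 2 ∂q₀ + ENNReal.ofReal (√(2 * γx)) ^ 2 * (dx * ENNReal.ofReal T)))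
    (by simp only [Function.uncurry_def]; fun_prop)
    (C := C) (fun s => ?_) (fun t => ?_) ?_ ?_ hT ?_ (fun t ht => ?_) ?_
  · exact hG.section_right _
  · fun_prop
  · filter_upwards [h.wiener.ae_continuous] with ω hω
    fun_prop
  · exact (h.ae_state_eq hGc).mono fun ω hω => hω.1
  · have := hq₀.ne
    rw [lt_top_iff_ne_top]
    finiteness
  · calc ∫⁻ ω, ‖epair (X 0 ω) (U 0 ω) + noiseEmbed γx (W t.toNNReal ω)‖ₑ ^ 2 ∂P
        ≤ ∫⁻ ω, 2 * (‖epair (X 0 ω) (U 0 ω)‖ₑ ^ 2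
          + ENNReal.ofReal (√(2 * γx)) ^ 2 * ‖W t.toNNReal ω‖ₑ ^ 2) ∂P := by
          refine lintegral_mono fun ω => ?_
          refine (pow_le_pow_left₀ zero_le (enorm_add_le _ _) 2).trans
            ((ENNReal.add_sq_le_two_mul _ _).trans (le_of_eq ?_))
          rw [← mul_pow, ← ofReal_norm (noiseEmbed _ _), norm_noiseEmbed,
            ENNReal.ofReal_mul (Real.sqrt_nonneg _), ofReal_norm]
      _ = 2 * (∫⁻ z, ‖z‖ₑ ^ 2 ∂q₀
          + ENNReal.ofReal (√(2 * γx)) ^ 2 * (dx * (t.toNNReal : ℝ≥0∞))) := by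
          rw [lintegral_const_mul _ (by fun_prop), lintegral_add_left (by fun_prop),
            lintegral_const_mul _ (by fun_prop), h.wiener.lintegral_enorm_sq, ← h.init_law,
            pairLaw, lintegral_map (by fun_prop) (by fun_prop)]
      _ ≤ _ := by
          gcongr
          exact ENNReal.ofReal_le_ofReal ht.2
  · filter_upwards [h.ae_state_eq hGc] with ω hω t ht
    exact hω.2 t ht.1

/-- The averaged drift of `(θ, m)` along the mean-field flow. -/
theorem IsMeanFieldFlow.exists_mean_drift [IsProbabilityMeasure P]
    (h : IsMeanFieldFlow P ell ηθ γθ ηx γx θ₀ m₀ q₀ W θ m X U)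
    (hq₀ : ∫⁻ z, ‖z‖ₑ ^ 2 ∂q₀ < ∞)
    {C : ℝ≥0} (hG : LipschitzWith C (stateDrift ell ηx γx))
    (hH : LipschitzWith C (paramDrift ell ηθ γθ)) {T : ℝ} (hT : 0 ≤ T) :
    ∃ (hbar : ℝ → EPair dθ dθ) (S : ℝ≥0∞), Measurable hbar ∧
      IntervalIntegrable hbar volume 0 T ∧ S < ∞ ∧
      (∀ t ∈ Set.Icc 0 T, epair (θ t.toNNReal) (m t.toNNReal)
        = epair θ₀ m₀ + ∫ s in (0 : ℝ)..t, hbar s) ∧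
      (∀ s ∈ Set.Icc 0 T, hbar s = ∫ z, paramDrift ell ηθ γθ
        (epair (θ s.toNNReal) (m s.toNNReal), z) ∂(pairLaw P (X s.toNNReal) (U s.toNNReal))) ∧
      ∀ s ∈ Set.Icc 0 T, ∫⁻ z, ‖paramDrift ell ηθ γθ
        (epair (θ s.toNNReal) (m s.toNNReal), z)‖ₑ ^ 2
          ∂(pairLaw P (X s.toNNReal) (U s.toNNReal)) ≤ S := by
  have hXm := h.measurable_X
  have hUm := h.measurable_U
  have hθ := h.continuous_θ
  have hm := h.continuous_m
  have hHc := hH.continuous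
  have hHm : Measurable (paramDrift ell ηθ γθ) := hHc.measurable
  set Θ : ℝ → EPair dθ dθ := fun s => epair (θ s.toNNReal) (m s.toNNReal) with hΘ
  have hΘc : Continuous Θ := by fun_prop
  obtain ⟨S₀, hS₀, hZ2⟩ := h.exists_moment_bound hq₀ hG hT
  obtain ⟨B, hB⟩ := (isCompact_Icc (a := (0 : ℝ)) (b := T)).exists_bound_of_continuousOn
    (f := fun s => paramDrift ell ηθ γθ (Θ s, 0)) (by fun_prop)
  -- Joint measurability of `Z'` makes its averaged drift measurable in time.
  obtain ⟨Z', hZ'm, hZ'c, hZ'⟩ := exists_continuous_modification (P := P)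
    (Z := fun (t : ℝ) ω => epair (X t.toNNReal ω) (U t.toNNReal ω)) (fun t => by fun_prop)
    ((h.ae_state_eq hG.continuous).mono fun ω hω => hω.1)
  -- From the linear growth `‖paramDrift (Θ s, z)‖ ≤ B + C * ‖z‖`, with `B` the bound at `z = 0`.
  set S : ℝ≥0∞ := 2 * (ENNReal.ofReal B ^ 2 + (C : ℝ≥0∞) ^ 2 * S₀) with hSdef
  have hS : S < ∞ := by
    have := hS₀.ne
    rw [lt_top_iff_ne_top]
    finiteness
  have hpm : ∀ s : ℝ, Measurable fun ω => epair (X s.toNNReal ω) (U s.toNNReal ω) := fun s => by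
    fun_prop
  have hHω : ∀ s ∈ Set.Icc 0 T, ∫⁻ ω, ‖paramDrift ell ηθ γθ
      (Θ s, epair (X s.toNNReal ω) (U s.toNNReal ω))‖ₑ ^ 2 ∂P ≤ S := by
    intro s hs
    calc _ ≤ ∫⁻ ω, 2 * (ENNReal.ofReal B ^ 2 + (C : ℝ≥0∞) ^ 2 *
          ‖epair (X s.toNNReal ω) (U s.toNNReal ω)‖ₑ ^ 2) ∂P := by
          refine lintegral_mono fun ω => ?_
          refine le_trans (pow_le_pow_left₀ zero_le ?_ 2)
            ((ENNReal.add_sq_le_two_mul (ENNReal.ofReal B)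
              (C * ‖epair (X s.toNNReal ω) (U s.toNNReal ω)‖ₑ)).trans_eq (by rw [mul_pow]))
          have hB0 : 0 ≤ B := (norm_nonneg _).trans (hB s hs)
          rw [← ofReal_norm, ← ofReal_norm, ← ENNReal.ofReal_coe_nnreal,
            ← ENNReal.ofReal_mul (NNReal.coe_nonneg C), ← ENNReal.ofReal_add hB0 (by positivity)]
          refine ENNReal.ofReal_le_ofReal ?_
          have h1 := hH.norm_sub_le_add (Θ s) (Θ s) (epair (X s.toNNReal ω) (U s.toNNReal ω)) 0
          rw [sub_self, norm_zero, zero_add, sub_zero] at h1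
          have h2 := hB s hs
          have h3 := norm_le_norm_add_norm_sub' (paramDrift ell ηθ γθ
            (Θ s, epair (X s.toNNReal ω) (U s.toNNReal ω))) (paramDrift ell ηθ γθ (Θ s, 0))
          linarith
      _ ≤ S := by
          rw [lintegral_const_mul _ (by fun_prop), lintegral_add_left (by fun_prop),
            lintegral_const_mul _ (by fun_prop), lintegral_const, measure_univ, mul_one,
            hSdef]
          gcongr
          exact hZ2 s hs
  have hHint : ∀ s ∈ Set.Icc 0 T, Integrable (fun ω => paramDrift ell ηθ γθ
      (Θ s, epair (X s.toNNReal ω) (U s.toNNReal ω))) P := fun s hs => by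
    have : MemLp (fun ω => paramDrift ell ηθ γθ
        (Θ s, epair (X s.toNNReal ω) (U s.toNNReal ω))) 2 P :=
      ⟨Measurable.aestronglyMeasurable (by fun_prop), by
        rw [eLpNorm_lt_top_iff_lintegral_rpow_enorm_lt_top (by norm_num) (by norm_num)]
        simpa using (hHω s hs).trans_lt hS⟩
    exact this.integrable (by norm_num)
  set hbar : ℝ → EPair dθ dθ := fun s => ∫ ω, paramDrift ell ηθ γθ (Θ s, Z' s ω) ∂P with hbardef
  have hbar_eq : ∀ s, hbar s = ∫ ω, paramDrift ell ηθ γθ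
      (Θ s, epair (X s.toNNReal ω) (U s.toNNReal ω)) ∂P := fun s => by
    refine integral_congr_ae ?_
    filter_upwards [hZ'] with ω hω
    rw [hω]
  have hbm : Measurable hbar := by
    refine StronglyMeasurable.measurable (StronglyMeasurable.integral_prod_right
      (f := fun s ω => paramDrift ell ηθ γθ (Θ s, Z' s ω)) ?_)
    exact (hHm.comp ((hΘc.measurable.comp measurable_fst).prodMk hZ'm)).stronglyMeasurable
  have hbi : IntervalIntegrable hbar volume 0 T := by
    rw [intervalIntegrable_iff_integrableOn_Icc_of_le hT]
    refine Measure.integrableOn_of_bounded (M := √S.toReal) (by simp) hbm.aestronglyMeasurable ?_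
    refine (ae_restrict_iff' measurableSet_Icc).2 (ae_of_all _ fun s hs => ?_)
    have h1 : ‖hbar s‖ₑ ^ 2 ≤ S := by
      rw [hbar_eq s]
      refine (pow_le_pow_left₀ zero_le (enorm_integral_le_lintegral_enorm _) 2).trans
        (le_trans (sq_lintegral_le (Measurable.aemeasurable (by fun_prop))) ?_)
      rw [measure_univ, mul_one]
      exact hHω s hs
    refine Real.le_sqrt_of_sq_le ?_
    have h2 := ENNReal.toReal_mono hS.ne h1
    simpa using h2
  refine ⟨hbar, S, hbm, hbi, hS, fun t ht => ?_, fun s hs => ?_, fun s hs => ?_⟩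
  · have hbit : IntervalIntegrable hbar volume 0 t := hbi.mono_set (by
      rw [Set.uIcc_of_le ht.1, Set.uIcc_of_le hT]; exact Set.Icc_subset_Icc_right ht.2)
    have h1 := h.eq_θ t.toNNReal
    have h2 := h.eq_m t.toNNReal
    rw [Real.coe_toNNReal t ht.1] at h1 h2
    refine epair_ext ?_ ?_
    · rw [WithLp.add_fst, intervalIntegral_fst hbit]
      simp only [WithLp.toLp_fst]
      rw [h1]
      congr 1
      refine intervalIntegral.integral_congr fun s hs => ?_
      rw [Set.uIcc_of_le ht.1] at hs
      have hs' : s ∈ Set.Icc 0 T := ⟨hs.1, hs.2.trans ht.2⟩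
      simp only [hbar_eq s]
      -- The `θ`-component of the drift does not depend on the state, so averaging against a
      -- probability measure leaves it unchanged.
      have := (WithLp.fstL 2 ℝ (EVec dθ) (EVec dθ)).integral_comp_comm (hHint s hs')
      refine Eq.trans ?_ this
      simp [paramDrift, hΘ]
    · rw [WithLp.add_snd, intervalIntegral_snd hbit]
      simp only [WithLp.toLp_snd]
      rw [h2]
      congr 1
      refine intervalIntegral.integral_congr fun s hs => ?_
      rw [Set.uIcc_of_le ht.1] at hs
      have hs' : s ∈ Set.Icc 0 T := ⟨hs.1, hs.2.trans ht.2⟩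
      simp only [hbar_eq s]
      have hcomm := (WithLp.sndL 2 ℝ (EVec dθ) (EVec dθ)).integral_comp_comm (hHint s hs')
      refine Eq.trans ?_ hcomm
      have hgc : Continuous fun x : EVec dx => gradTheta ell (θ s.toNNReal) x := by
        have h3 : Continuous fun x : EVec dx => (paramDrift ell ηθ γθ (Θ s, epair x 0)).snd
          + (γθ * ηθ) • m s.toNNReal :=
          ((WithLp.continuous_snd 2 _ _).comp (by fun_prop)).add continuous_const
        simpa [paramDrift, hΘ] using h3
      -- Needed to split the friction term off the average; the integral of a non-integrable
      -- gradient would take the default value `0`.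
      have hgi : Integrable (fun ω => gradTheta ell (θ s.toNNReal) (X s.toNNReal ω)) P := by
        have h3 := ((WithLp.sndL 2 ℝ (EVec dθ) (EVec dθ)).integrable_comp (hHint s hs')).add
          (integrable_const ((γθ * ηθ) • m s.toNNReal))
        refine h3.congr (ae_of_all _ fun ω => ?_)
        simp [paramDrift, hΘ]
      rw [integral_map (hXm _).aemeasurable hgc.aestronglyMeasurable]
      simp only [paramDrift, hΘ, WithLp.sndL_apply, WithLp.toLp_fst, WithLp.toLp_snd]
      rw [integral_sub hgi (integrable_const _)]
      simp
  · rw [hbar_eq s, pairLaw, integral_map (hpm s).aemeasurable]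
    exact Measurable.aestronglyMeasurable (by fun_prop)
  · rw [pairLaw, lintegral_map (by fun_prop) (hpm s)]
    exact hHω s hs

end Flow

/-! ### The particle system in phase space -/

section Particles

variable {dθ dx : ℕ} {ell : EPair dθ dx → ℝ} {Ω : Type*} [MeasurableSpace Ω] {P : Measure Ω}
  {ηθ γθ ηx γx : ℝ} {θ₀ m₀ : EVec dθ} {q₀ : Measure (EPair dx dx)} {M : ℕ}
  {W : Fin M → ℝ≥0 → Ω → EVec dx} {θ m : ℝ≥0 → Ω → EVec dθ} {X U : Fin M → ℝ≥0 → Ω → EVec dx}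

theorem IsParticleSystem.ae_continuous_param
    (h : IsParticleSystem M P ell ηθ γθ ηx γx θ₀ m₀ q₀ W θ m X U) :
    ∀ᵐ ω ∂P, Continuous fun t : ℝ => epair (θ t.toNNReal ω) (m t.toNNReal ω) := by
  filter_upwards [h.continuous_θ, h.continuous_m] with ω h1 h2
  fun_prop

theorem IsParticleSystem.ae_state_eq
    (h : IsParticleSystem M P ell ηθ γθ ηx γx θ₀ m₀ q₀ W θ m X U)
    (hG : Continuous (stateDrift ell ηx γx)) (i : Fin M) :
    ∀ᵐ ω ∂P, Continuous (fun t : ℝ => epair (X i t.toNNReal ω) (U i t.toNNReal ω)) ∧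
      ∀ t : ℝ, 0 ≤ t → epair (X i t.toNNReal ω) (U i t.toNNReal ω)
        = epair (X i 0 ω) (U i 0 ω) + noiseEmbed γx (W i t.toNNReal ω)
          + ∫ s in (0 : ℝ)..t, stateDrift ell ηx γx (epair (θ s.toNNReal ω) (m s.toNNReal ω),
              epair (X i s.toNNReal ω) (U i s.toNNReal ω)) := by
  filter_upwards [h.continuous_θ, h.continuous_m, h.continuous_X i, h.continuous_U i, h.eq_X i,
    h.eq_U i] with ω h1 h2 h3 h4 h5 h6
  exact ⟨by fun_prop, fun t ht => epair_state_eq hG h1 h2 h3 h4 h5 h6 (w := fun t => W i t ω) ht⟩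

theorem fst_sum {a b : ℕ} {ι : Type*} (s : Finset ι) (f : ι → EPair a b) :
    (∑ i ∈ s, f i).fst = ∑ i ∈ s, (f i).fst :=
  map_sum (WithLp.fstL 2 ℝ (EVec a) (EVec b)) f s

theorem snd_sum {a b : ℕ} {ι : Type*} (s : Finset ι) (f : ι → EPair a b) :
    (∑ i ∈ s, f i).snd = ∑ i ∈ s, (f i).snd :=
  map_sum (WithLp.sndL 2 ℝ (EVec a) (EVec b)) f s

/-- The `θ`-component and the friction do not depend on `i`, so averaging them over `M > 0`
particles gives them back, and the whole parameter drift becomes one empirical mean. -/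
theorem IsParticleSystem.ae_param_eq
    (h : IsParticleSystem M P ell ηθ γθ ηx γx θ₀ m₀ q₀ W θ m X U) (hM : 0 < M)
    (hH : Continuous (paramDrift ell ηθ γθ)) :
    ∀ᵐ ω ∂P, ∀ t : ℝ, 0 ≤ t → epair (θ t.toNNReal ω) (m t.toNNReal ω)
      = epair θ₀ m₀ + ∫ s in (0 : ℝ)..t, (M : ℝ)⁻¹ • ∑ i, paramDrift ell ηθ γθ
          (epair (θ s.toNNReal ω) (m s.toNNReal ω),
            epair (X i s.toNNReal ω) (U i s.toNNReal ω)) := by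
  have hM0 : (M : ℝ) ≠ 0 := by exact_mod_cast hM.ne'
  filter_upwards [h.continuous_θ, h.continuous_m, ae_all_iff.2 h.continuous_X,
    ae_all_iff.2 h.continuous_U, h.eq_θ, h.eq_m] with ω h1 h2 h3 h4 h5 h6 t ht
  have hint : IntervalIntegrable (fun s : ℝ => (M : ℝ)⁻¹ • ∑ i, paramDrift ell ηθ γθ
      (epair (θ s.toNNReal ω) (m s.toNNReal ω),
        epair (X i s.toNNReal ω) (U i s.toNNReal ω))) volume 0 t :=
    Continuous.intervalIntegrable (by fun_prop) _ _
  have h7 := h5 t.toNNReal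
  have h8 := h6 t.toNNReal
  rw [Real.coe_toNNReal t ht] at h7 h8
  refine epair_ext ?_ ?_
  · rw [WithLp.add_fst, intervalIntegral_fst hint]
    simp only [WithLp.smul_fst, fst_sum, paramDrift, WithLp.toLp_fst, WithLp.toLp_snd,
      Finset.sum_const, Finset.card_univ, Fintype.card_fin, ← Nat.cast_smul_eq_nsmul ℝ,
      inv_smul_smul₀ hM0]
    exact h7
  · rw [WithLp.add_snd, intervalIntegral_snd hint]
    simp only [WithLp.smul_snd, snd_sum, paramDrift, WithLp.toLp_fst, WithLp.toLp_snd,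
      Finset.sum_sub_distrib, smul_sub, Finset.sum_const, Finset.card_univ, Fintype.card_fin,
      ← Nat.cast_smul_eq_nsmul ℝ, inv_smul_smul₀ hM0]
    exact h8

/-- A coupling bounds the squared Wasserstein distance of laws of random configurations. -/
theorem configW2Sq_map_le {d : ℕ} {Y Z : Fin M → Ω → EPair d d} (hY : ∀ i, Measurable (Y i))
    (hZ : ∀ i, Measurable (Z i)) :
    configW2Sq (P.map fun ω i => Y i ω) (P.map fun ω i => Z i ω)
      ≤ ∫⁻ ω, (∑ i, ‖Y i ω - Z i ω‖ₑ ^ 2) / (M : ℝ≥0∞) ∂P := by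
  have hYm : Measurable fun ω i => Y i ω := measurable_pi_lambda _ hY
  have hZm : Measurable fun ω i => Z i ω := measurable_pi_lambda _ hZ
  refine (iInf₂_le (P.map fun ω => ((fun i => Y i ω), fun i => Z i ω)) ⟨?_, ?_⟩).trans ?_
  · rw [lintegral_map (by fun_prop) (hYm.prodMk hZm)]
  · rw [Measure.map_map measurable_fst (hYm.prodMk hZm)]; rfl
  · rw [Measure.map_map measurable_snd (hYm.prodMk hZm)]; rfl

end Particles

/-! ### Propagation of chaos -/

/-- Independent copies of the mean-field flow, driven by the noises and initial points of the
particle system. -/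
theorem exists_mean_field_copies {dθ dx : ℕ} {ell : EPair dθ dx → ℝ} {ηθ γθ ηx γx : ℝ}
    {θ₀ m₀ : EVec dθ} {q₀ : Measure (EPair dx dx)}
    {Ω : Type*} [MeasurableSpace Ω] {P : Measure Ω} [IsProbabilityMeasure P]
    {W : ℝ≥0 → Ω → EVec dx} {θ m : ℝ≥0 → EVec dθ} {X U : ℝ≥0 → Ω → EVec dx}
    (hflow : IsMeanFieldFlow P ell ηθ γθ ηx γx θ₀ m₀ q₀ W θ m X U) {M : ℕ}
    {Ω' : Type*} [MeasurableSpace Ω'] {P' : Measure Ω'} [IsProbabilityMeasure P']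
    {W' : Fin M → ℝ≥0 → Ω' → EVec dx} {θ' m' : ℝ≥0 → Ω' → EVec dθ}
    {X' U' : Fin M → ℝ≥0 → Ω' → EVec dx}
    (hp : IsParticleSystem M P' ell ηθ γθ ηx γx θ₀ m₀ q₀ W' θ' m' X' U')
    {C : ℝ≥0} (hG : LipschitzWith C (stateDrift ell ηx γx)) {T : ℝ} (hT : 0 ≤ T) :
    ∃ Y : Fin M → ℝ → Ω' → EPair dx dx, (∀ i, Measurable (Function.uncurry (Y i))) ∧
      (∀ i ω, Continuous fun t => Y i t ω) ∧
      (∀ s ∈ Set.Icc 0 T, ∀ i, P'.map (Y i s) = pairLaw P (X s.toNNReal) (U s.toNNReal)) ∧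
      (∀ s ∈ Set.Icc 0 T, iIndepFun (fun i => Y i s) P') ∧
      ∀ i, ∀ᵐ ω ∂P', ∀ t ∈ Set.Icc 0 T, Y i t ω
        = epair (X' i 0 ω) (U' i 0 ω) + noiseEmbed γx (W' i t.toNNReal ω)
          + ∫ s in (0 : ℝ)..t, stateDrift ell ηx γx
              (epair (θ s.toNNReal) (m s.toNNReal), Y i s ω) := by
  have hGc := hG.continuous
  have hθ := hflow.continuous_θ
  have hm := hflow.continuous_m
  have hXm := hflow.measurable_X
  have hUm := hflow.measurable_U
  have hJ := measurable_noiseEmbed (dx := dx) γx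
  have hX'm := hp.measurable_X
  have hU'm := hp.measurable_U
  have hW'm := fun i => (hp.wiener i).measurable
  set F : ℝ → EPair dx dx → EPair dx dx := fun s z => stateDrift ell ηx γx (epair (θ s.toNNReal) (m s.toNNReal), z) with hFdef
  have hF : Continuous (Function.uncurry F) := by
    simp only [hFdef, Function.uncurry_def]; fun_prop
  have hFL : ∀ s, LipschitzWith C (F s) := fun s => hG.section_right _
  choose Y hYm hYc hYsol hYeq using fun i => exists_pathSolution_process (P := P') hF hFL
    (continuous_noiseEmbed (dx := dx) γx) hJ
    (x := fun ω => epair (X' i 0 ω) (U' i 0 ω)) (by fun_prop) (W := W' i)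
    (hW'm i) (hp.wiener i).ae_continuous hT
  have hpsm : ∀ s, Measurable (pathSolution F (noiseEmbed (dx := dx) γx) s) :=
    measurable_pathSolution (fun s => (hFL s).continuous.measurable) hJ
  have hdata : ∀ i, Measurable fun ω => (epair (X' i 0 ω) (U' i 0 ω), fun t => W' i t ω) :=
    fun i => Measurable.prodMk (by fun_prop) (measurable_pi_lambda _ (hW'm i))
  have hdata₀ : Measurable fun ω => (epair (X 0 ω) (U 0 ω), fun t => W t ω) :=
    Measurable.prodMk (by fun_prop) (measurable_pi_lambda _ hflow.wiener.measurable)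
  -- Uniqueness in law across the two spaces: both sides are images of the pair (initial point,
  -- noise path) under the same measurable functional, and these pairs have equal laws.
  have hν : ∀ s ∈ Set.Icc 0 T, ∀ i,
      P'.map (Y i s) = pairLaw P (X s.toNNReal) (U s.toNNReal) := by
    intro s hs i
    have h1 : P'.map (Y i s) = P'.map (pathSolution F (noiseEmbed γx) s ∘
        fun ω => (epair (X' i 0 ω) (U' i 0 ω), fun t => W' i t ω)) :=
      Measure.map_congr (hYsol i s hs)
    have h2 : pairLaw P (X s.toNNReal) (U s.toNNReal) = P.map (pathSolution F (noiseEmbed γx) s ∘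
        fun ω => (epair (X 0 ω) (U 0 ω), fun t => W t ω)) := by
      refine Measure.map_congr ?_
      filter_upwards [hflow.ae_state_eq hGc] with ω hω
      exact (pathSolution_eq hF hFL (J := noiseEmbed γx) (x := epair (X 0 ω) (U 0 ω))
        (w := fun t => W t ω) (z := fun t => epair (X t.toNNReal ω) (U t.toNNReal ω))
        hω.1 hs.1 fun r hr => hω.2 r hr.1).symm
    have h3 := map_prodMk_wiener_eq (hp.wiener i) hflow.wiener (z := fun ω =>
      epair (X' i 0 ω) (U' i 0 ω)) (z' := fun ω => epair (X 0 ω) (U 0 ω)) (by fun_prop)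
      (by fun_prop) ((hp.init_law i).trans hflow.init_law.symm) (hp.init_indep i) hflow.init_indep
    exact h1.trans ((Measure.map_map (hpsm s) (hdata i)).symm.trans
      ((congrArg (Measure.map (pathSolution F (noiseEmbed γx) s)) h3).trans
        ((Measure.map_map (hpsm s) hdata₀).trans h2.symm)))
  have hind : ∀ s ∈ Set.Icc 0 T, iIndepFun (fun i => Y i s) P' := by
    intro s hs
    refine (hp.indep.comp (fun _ => pathSolution F (noiseEmbed γx) s) fun _ => hpsm s).congr
      fun i => ?_
    filter_upwards [hYsol i s hs] with ω hω
    exact hω.symm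
  exact ⟨Y, hYm, hYc, hν, hind, hYeq⟩

/-- The `M`-particle error is of order `1 / M`. -/
theorem exists_particle_error_bound {dθ dx : ℕ}
    {ell : EPair dθ dx → ℝ} (hell : HasLipschitzGradient ell) {ηθ γθ ηx γx : ℝ}
    {θ₀ m₀ : EVec dθ} {q₀ : Measure (EPair dx dx)} (hq₀ : ∫⁻ z, ‖z‖ₑ ^ 2 ∂q₀ < ∞)
    {Ω : Type*} [MeasurableSpace Ω] {P : Measure Ω} [IsProbabilityMeasure P]
    {W : ℝ≥0 → Ω → EVec dx} {θ m : ℝ≥0 → EVec dθ} {X U : ℝ≥0 → Ω → EVec dx}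
    (hflow : IsMeanFieldFlow P ell ηθ γθ ηx γx θ₀ m₀ q₀ W θ m X U) (T : ℝ≥0) :
    ∃ R : ℝ≥0∞, R < ∞ ∧ ∀ (M : ℕ), 0 < M → ∀ {Ω' : Type*} [MeasurableSpace Ω'] (P' : Measure Ω')
      [IsProbabilityMeasure P'] (W' : Fin M → ℝ≥0 → Ω' → EVec dx) (θ' m' : ℝ≥0 → Ω' → EVec dθ)
      (X' U' : Fin M → ℝ≥0 → Ω' → EVec dx),
      IsParticleSystem M P' ell ηθ γθ ηx γx θ₀ m₀ q₀ W' θ' m' X' U' →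
      ∫⁻ ω, ⨆ t ∈ Set.Icc (0 : ℝ≥0) T,
          (‖epair (θ t) (m t) - epair (θ' t ω) (m' t ω)‖ₑ ^ 2
            + configW2Sq (Measure.pi (fun _ : Fin M => pairLaw P (X t) (U t)))
                (particleLaw P' (fun i => X' i t) (fun i => U' i t))) ∂P' ≤ R / M := by
  obtain ⟨C, hG, hH⟩ := hell.exists_lipschitzWith_drifts ηθ γθ ηx γx
  have hT : (0 : ℝ) ≤ T := T.2
  obtain ⟨hbar, S, hbm, hbi, hS, hΘ, hbar_eq, hS2⟩ := hflow.exists_mean_drift hq₀ hG hH hT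
  have hGc := hG.continuous
  have hθ := hflow.continuous_θ
  have hm := hflow.continuous_m
  set Θ : ℝ → EPair dθ dθ := fun s => epair (θ s.toNNReal) (m s.toNNReal) with hΘdef
  have hΘc : Continuous Θ := by fun_prop
  set K : ℝ≥0∞ := ENNReal.ofReal ((1 + C * (T : ℝ)) * Real.exp (3 * C * (T : ℝ))) with hK
  -- The parameter error and the transport cost each contribute `K ^ 2` times the second moment of
  -- `D`, hence the factor `2`. No constant depends on `M` or on the space carrying the particles.
  refine ⟨2 * (K ^ 2 * (S * ENNReal.ofReal T ^ 2)), ?_, ?_⟩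
  · have := hS.ne
    rw [lt_top_iff_ne_top]
    finiteness
  intro M hM Ω' _ P' _ W' θ' m' X' U' hp
  have hX'm := hp.measurable_X
  have hU'm := hp.measurable_U
  obtain ⟨Y, hYm, hYc, hν, hind, hYeq⟩ := exists_mean_field_copies hflow hp hG hT
  obtain ⟨D, hDm, hD2, hDle⟩ := exists_coupling_error (P := P') hT hG hH hΘc hbm hbi hΘ hbar_eq hS
    hS2 hM (Θ' := fun s ω => epair (θ' s.toNNReal ω) (m' s.toNNReal ω)) hp.ae_continuous_param
    (Y := Y) (Z := fun i s ω => epair (X' i s.toNNReal ω) (U' i s.toNNReal ω))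
    (n := fun i s ω => epair (X' i 0 ω) (U' i 0 ω) + noiseEmbed γx (W' i s.toNNReal ω))
    hYm hYc (fun i => (hp.ae_state_eq hGc i).mono fun ω hω => hω.1) hν hind
    ((hp.ae_param_eq hM hH.continuous).mono fun ω hω t ht => hω t ht.1) hYeq
    (fun i => (hp.ae_state_eq hGc i).mono fun ω hω t ht => hω.2 t ht.1)
  have hmem : ∀ t ∈ Set.Icc (0 : ℝ≥0) T, (t : ℝ) ∈ Set.Icc (0 : ℝ) T := fun t ht =>
    ⟨t.2, by exact_mod_cast ht.2⟩
  have hW2 : ∀ t ∈ Set.Icc (0 : ℝ≥0) T,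
      configW2Sq (Measure.pi (fun _ : Fin M => pairLaw P (X t) (U t)))
        (particleLaw P' (fun i => X' i t) (fun i => U' i t)) ≤ K ^ 2 * ∫⁻ ω, D ω ^ 2 ∂P' := by
    intro t ht
    have hYt : ∀ i, Measurable (Y i t) := fun i => (hYm i).of_uncurry_left
    have hpi : Measure.pi (fun _ : Fin M => pairLaw P (X t) (U t)) = P'.map fun ω i => Y i t ω := by
      rw [(iIndepFun_iff_map_fun_eq_pi_map fun i => (hYt i).aemeasurable).1 (hind t (hmem t ht))]
      simp_rw [hν t (hmem t ht), Real.toNNReal_coe]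
    rw [hpi, particleLaw]
    refine (configW2Sq_map_le hYt fun i => by fun_prop).trans ?_
    rw [← lintegral_const_mul _ (hDm.pow_const 2)]
    refine lintegral_mono_ae ?_
    filter_upwards [hDle] with ω hω
    refine ENNReal.div_le_of_le_mul ?_
    calc ∑ i, ‖Y i t ω - epair (X' i t ω) (U' i t ω)‖ₑ ^ 2 ≤ ∑ _i : Fin M, (K * D ω) ^ 2 := by
          refine Finset.sum_le_sum fun i _ => pow_le_pow_left₀ zero_le ?_ 2
          simpa using (hω t (hmem t ht)).2 i
      _ = K ^ 2 * D ω ^ 2 * M := by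
          rw [Finset.sum_const, Finset.card_univ, Fintype.card_fin, nsmul_eq_mul]; ring
  calc _ ≤ ∫⁻ ω, (K ^ 2 * D ω ^ 2 + K ^ 2 * ∫⁻ ω, D ω ^ 2 ∂P') ∂P' := by
        refine lintegral_mono_ae ?_
        filter_upwards [hDle] with ω hω
        -- The bound is uniform in `t`, so the supremum is dominated by a measurable function of `ω`
        -- and its own measurability is not needed. The Wasserstein term is not random.
        refine iSup₂_le fun t ht => add_le_add ?_ (hW2 t ht)
        rw [← mul_pow]
        refine pow_le_pow_left₀ zero_le ?_ 2
        simpa [hΘdef] using (hω t (hmem t ht)).1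
    _ = 2 * (K ^ 2 * ∫⁻ ω, D ω ^ 2 ∂P') := by
        rw [lintegral_add_left (by fun_prop), lintegral_const_mul _ (by fun_prop), lintegral_const,
          measure_univ, mul_one, two_mul]
    _ ≤ 2 * (K ^ 2 * (S / M * ENNReal.ofReal T ^ 2)) := by gcongr
    _ = _ := by simp only [div_eq_mul_inv]; ring

theorem proposition2 {dθ dx : ℕ}
    (ell : EPair dθ dx → ℝ) (hell : HasLipschitzGradient ell)
    (ηθ γθ ηx γx : ℝ) (hηθ : 0 < ηθ) (hγθ : 0 < γθ) (hηx : 0 < ηx) (hγx : 0 < γx)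
    (θ₀ m₀ : EVec dθ) (q₀ : Measure (EPair dx dx)) [IsProbabilityMeasure q₀]
    (hq₀ : ∫⁻ z, ‖z‖ₑ ^ 2 ∂q₀ < ∞)
    -- the mean-field flow
    {Ω : Type*} [MeasurableSpace Ω] (P : Measure Ω) [IsProbabilityMeasure P]
    (W : ℝ≥0 → Ω → EVec dx) (θ m : ℝ≥0 → EVec dθ) (X U : ℝ≥0 → Ω → EVec dx)
    (hflow : IsMeanFieldFlow P ell ηθ γθ ηx γx θ₀ m₀ q₀ W θ m X U)
    -- the particle systems, one for each number `M ≥ 1` of particles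
    {Ω' : ℕ → Type*} [∀ M, MeasurableSpace (Ω' M)]
    (P' : ∀ M, Measure (Ω' M)) [∀ M, IsProbabilityMeasure (P' M)]
    (W' : ∀ M, Fin M → ℝ≥0 → Ω' M → EVec dx)
    (θ' m' : ∀ M, ℝ≥0 → Ω' M → EVec dθ)
    (X' U' : ∀ M, Fin M → ℝ≥0 → Ω' M → EVec dx)
    (hpart : ∀ M, 0 < M →
      IsParticleSystem M (P' M) ell ηθ γθ ηx γx θ₀ m₀ q₀ (W' M) (θ' M) (m' M) (X' M) (U' M))
    (T : ℝ≥0) :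
    Tendsto
      (fun M : ℕ => ∫⁻ ω, ⨆ t ∈ Set.Icc (0 : ℝ≥0) T,
          (‖epair (θ t) (m t) - epair (θ' M t ω) (m' M t ω)‖ₑ ^ 2
            + configW2Sq (Measure.pi (fun _ : Fin M => pairLaw P (X t) (U t)))
                (particleLaw (P' M) (fun i => X' M i t) (fun i => U' M i t)))
        ∂(P' M))
      atTop (𝓝 0) := by
  obtain ⟨R, hR, hbound⟩ := exists_particle_error_bound hell hq₀ hflow T
  have hlim : Tendsto (fun M : ℕ => R / (M : ℝ≥0∞)) atTop (𝓝 0) := by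
    simpa using ENNReal.Tendsto.const_div ENNReal.tendsto_nat_nhds_top (Or.inr hR.ne)
  refine tendsto_of_tendsto_of_tendsto_of_le_of_le' tendsto_const_nhds hlim
    (Eventually.of_forall fun _ => zero_le) ?_
  filter_upwards [eventually_gt_atTop 0] with M hM
  exact hbound M hM (P' M) (W' M) (θ' M) (m' M) (X' M) (U' M) (hpart M hM)
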